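/- Let $k\ge 1$ be an integer, $p\ge 1$ a real number and $\alpha_0,\dots,\alpha_k,\theta\in\mathbb R$. For $q\ge1$ and $a\in\mathbb R$ let $L^q_a=L^q_a(0,\infty)$ be the space of (classes of) measurable functions $u:(0,\infty)\to\mathbb R$ with $\|u\|_{L^q_a}=\left(\int_0^\infty|u(r)|^q r^a\,dr\right)^{1/q}<\infty$. Let $X^{k,p}_\infty=X^{k,p}_\infty(\alpha_0,\dots,\alpha_k)$ be the space of functions $u$ on $(0,\infty)$ whose weak derivatives $u^{(j)}$ (on the open half-line $(0,\infty)$) exist and satisfy $u^{(j)}\in L^p_{\alpha_j}$ for $j=0,1,\dots,k$, with the norm $\|u\|_{X^{k,p}_\infty}=\left(\sum_{j=0}^k\|u^{(j)}\|_{L^p_{\alpha_j}}^p\right)^{1/p}$. Assume that $\alpha_j\ge\alpha_k-(k-j)p$ for all $j=0,\dots,k-1$ and that $\alpha_k-kp\le\theta\le\alpha_0$. (a) (Sobolev embedding.) Suppose $\alpha_k-kp+1>0$ and put $p^*=\dfrac{(\theta+1)p}{\alpha_k-kp+1}$. Then $X^{k,p}_\infty\subset L^q_\theta$ with continuous inclusion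 for all $p\le q\le p^*$. Moreover, this inclusion is compact if (i) $\theta=\alpha_0$ and $p<q<p^*$, or (ii) $\theta<\alpha_0$ and $p\le q<p^*$. (b) (Limiting Sobolev embedding.) Suppose $\alpha_k-kp+1=0$ (so that the assumption on $\theta$ reads $-1\le\theta\le\alpha_0$), and exclude the case $\theta=-1<\alpha_0$, that is, suppose $\theta>-1$ or $\theta=\alpha_0$. Then $X^{k,p}_\infty\subset L^q_\theta$ with continuous inclusion for all $p\le q<\infty$. Moreover, this inclusion is compact if (i) $\theta=\alpha_0>-1$ and $q>p>1$, or (ii) $\theta<\alpha_0$ and $q\ge p\ge1$. -/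

import Mathlib

open MeasureTheory Set
open scoped ENNReal ContDiff

namespace WeightedSobolev

/-- The measure `r ^ a dr` on the half-line `(0, ∞)`. -/
noncomputable def weight (a : ℝ) : Measure ℝ :=
  (volume.restrict (Ioi (0 : ℝ))).withDensity (fun r => ENNReal.ofReal (r ^ a))

/-- Measurable real functions on `(0, ∞)`, modulo equality almost everywhere. -/
abbrev Fun0 : Type := ℝ →ₘ[volume.restrict (Ioi (0 : ℝ))] ℝ

/-- `v` is the `j`-th weak derivative of `u` on `(0, ∞)`: both functions are locally integrable on
`(0, ∞)` and `∫ u φ⁽ʲ⁾ = (-1) ^ j ∫ v φ` for every test function `φ ∈ C_c^∞(0, ∞)`. -/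
def HasWeakDeriv (j : ℕ) (u v : ℝ → ℝ) : Prop :=
  LocallyIntegrableOn u (Ioi 0) ∧ LocallyIntegrableOn v (Ioi 0) ∧
    ∀ φ : ℝ → ℝ, ContDiff ℝ ∞ φ → HasCompactSupport φ → tsupport φ ⊆ Ioi 0 →
      ∫ r in Ioi 0, u r * iteratedDeriv j φ r = (-1) ^ j * ∫ r in Ioi 0, v r * φ r

theorem integrableOn_mul {u ψ : ℝ → ℝ} (hu : LocallyIntegrableOn u (Ioi 0)) (hψ : Continuous ψ)
    (hc : HasCompactSupport ψ) (hs : tsupport ψ ⊆ Ioi 0) :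
    IntegrableOn (fun r => u r * ψ r) (Ioi 0) := by
  have h1 : IntegrableOn u (tsupport ψ) := hu.integrableOn_compact_subset hs hc
  have h2 : IntegrableOn (fun r => u r * ψ r) (tsupport ψ) :=
    h1.mul_continuousOn hψ.continuousOn hc
  have h3 : Integrable (fun r => u r * ψ r) := by
    refine (integrableOn_iff_integrable_of_support_subset ?_).1 h2
    intro r hr
    exact subset_tsupport ψ (right_ne_zero_of_mul hr)
  exact h3.integrableOn

theorem tsupport_iteratedDeriv_subset (φ : ℝ → ℝ) (j : ℕ) :
    tsupport (iteratedDeriv j φ) ⊆ tsupport φ := by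
  induction j with
  | zero => simp
  | succ j ih =>
    rw [iteratedDeriv_succ]
    exact (closure_minimal support_deriv_subset (isClosed_tsupport _)).trans ih

theorem integrableOn_mul_iteratedDeriv {u φ : ℝ → ℝ} (hu : LocallyIntegrableOn u (Ioi 0))
    (hφ : ContDiff ℝ ∞ φ) (hc : HasCompactSupport φ) (hs : tsupport φ ⊆ Ioi 0) (j : ℕ) :
    IntegrableOn (fun r => u r * iteratedDeriv j φ r) (Ioi 0) := by
  have hsub := tsupport_iteratedDeriv_subset φ j
  refine integrableOn_mul hu (hφ.continuous_iteratedDeriv j (by exact_mod_cast le_top)) ?_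
    (hsub.trans hs)
  exact IsCompact.of_isClosed_subset hc (isClosed_tsupport _) hsub

theorem HasWeakDeriv.congr {j : ℕ} {u u' v v' : ℝ → ℝ} (h : HasWeakDeriv j u v)
    (hu : u =ᵐ[volume.restrict (Ioi 0)] u') (hv : v =ᵐ[volume.restrict (Ioi 0)] v') :
    HasWeakDeriv j u' v' := by
  refine ⟨h.1.congr hu, h.2.1.congr hv, fun φ h1 h2 h3 => ?_⟩
  have e1 : ∫ r in Ioi 0, u r * iteratedDeriv j φ r = ∫ r in Ioi 0, u' r * iteratedDeriv j φ r :=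
    integral_congr_ae (by filter_upwards [hu] with r hr; rw [hr])
  have e2 : ∫ r in Ioi 0, v r * φ r = ∫ r in Ioi 0, v' r * φ r :=
    integral_congr_ae (by filter_upwards [hv] with r hr; rw [hr])
  rw [← e1, ← e2]
  exact h.2.2 φ h1 h2 h3

theorem HasWeakDeriv.add {j : ℕ} {u u' v v' : ℝ → ℝ} (h : HasWeakDeriv j u v)
    (h' : HasWeakDeriv j u' v') : HasWeakDeriv j (u + u') (v + v') := by
  refine ⟨h.1.add h'.1, h.2.1.add h'.2.1, fun φ h1 h2 h3 => ?_⟩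
  simp only [Pi.add_apply, add_mul]
  rw [integral_add (integrableOn_mul_iteratedDeriv h.1 h1 h2 h3 j)
      (integrableOn_mul_iteratedDeriv h'.1 h1 h2 h3 j),
    integral_add (integrableOn_mul h.2.1 h1.continuous h2 h3)
      (integrableOn_mul h'.2.1 h1.continuous h2 h3),
    h.2.2 φ h1 h2 h3, h'.2.2 φ h1 h2 h3, mul_add]

theorem HasWeakDeriv.smul {j : ℕ} {u v : ℝ → ℝ} (c : ℝ) (h : HasWeakDeriv j u v) :
    HasWeakDeriv j (c • u) (c • v) := by
  refine ⟨h.1.smul c, h.2.1.smul c, fun φ h1 h2 h3 => ?_⟩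
  simp only [Pi.smul_apply, smul_eq_mul, mul_assoc]
  rw [integral_const_mul, integral_const_mul, h.2.2 φ h1 h2 h3]
  ring

theorem HasWeakDeriv.zero (j : ℕ) : HasWeakDeriv j 0 0 :=
  ⟨locallyIntegrableOn_zero, locallyIntegrableOn_zero, fun φ _ _ _ => by simp⟩

/-- Weak derivatives are unique up to equality almost everywhere. -/
theorem HasWeakDeriv.unique {j : ℕ} {u v w : ℝ → ℝ} (hv : HasWeakDeriv j u v)
    (hw : HasWeakDeriv j u w) : v =ᵐ[volume.restrict (Ioi 0)] w := by
  have key : ∀ᵐ r ∂(volume : Measure ℝ), r ∈ Ioi (0 : ℝ) → (v - w) r = 0 := by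
    refine isOpen_Ioi.ae_eq_zero_of_integral_contDiff_smul_eq_zero (hv.2.1.sub hw.2.1) ?_
    intro φ h1 h2 h3
    have e : ∫ r in Ioi 0, v r * φ r = ∫ r in Ioi 0, w r * φ r := by
      have := (hv.2.2 φ h1 h2 h3).symm.trans (hw.2.2 φ h1 h2 h3)
      exact mul_left_cancel₀ (pow_ne_zero j (by norm_num)) this
    have e2 : ∫ r, φ r • (v - w) r = ∫ r in Ioi 0, (v r * φ r - w r * φ r) := by
      rw [← setIntegral_eq_integral_of_forall_compl_eq_zero (s := Ioi (0 : ℝ))]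
      · congr 1
        ext r
        simp only [Pi.sub_apply, smul_eq_mul]
        ring
      · intro r hr
        have : φ r = 0 := image_eq_zero_of_notMem_tsupport fun h => hr (h3 h)
        simp [this]
    rw [e2, integral_sub (integrableOn_mul hv.2.1 h1.continuous h2 h3)
      (integrableOn_mul hw.2.1 h1.continuous h2 h3), e, sub_self]
  rw [Filter.EventuallyEq, ae_restrict_iff' measurableSet_Ioi]
  filter_upwards [key] with r hr h0
  exact sub_eq_zero.1 (hr h0)

theorem weight_ac (a : ℝ) : weight a ≪ volume.restrict (Ioi (0 : ℝ)) :=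
  withDensity_absolutelyContinuous _ _

theorem ac_weight (a : ℝ) : volume.restrict (Ioi (0 : ℝ)) ≪ weight a := by
  refine withDensity_absolutelyContinuous' ?_ ?_
  · exact (Measurable.ennreal_ofReal (by fun_prop)).aemeasurable
  · filter_upwards [ae_restrict_mem measurableSet_Ioi] with r hr
    simpa using Real.rpow_pos_of_pos hr a

theorem ae_weight_iff (a : ℝ) {P : ℝ → Prop} :
    (∀ᵐ r ∂(weight a), P r) ↔ ∀ᵐ r ∂(volume.restrict (Ioi (0 : ℝ))), P r :=
  ⟨fun h => (ac_weight a).ae_le h, fun h => (weight_ac a).ae_le h⟩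

instance factOneLe (p : ℝ) [hp : Fact (1 ≤ p)] : Fact (1 ≤ ENNReal.ofReal p) :=
  ⟨by simpa using ENNReal.ofReal_le_ofReal hp.out⟩

/-- The weighted Lebesgue space `L^q_a(0, ∞)` of functions with `∫₀^∞ |u|^q r^a dr < ∞`. -/
abbrev WLp (q a : ℝ) : Type := Lp ℝ (ENNReal.ofReal q) (weight a)

/-- The linear space `X^{k,p}_∞(α₀, …, α_k)`: (classes of) functions `u` on `(0, ∞)` all of whose
weak derivatives of order `j = 0, …, k` exist and lie in `L^p_{α_j}`. -/
def carrier (k : ℕ) (p : ℝ) (α : Fin (k + 1) → ℝ) : Submodule ℝ Fun0 where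
  carrier := {u | ∀ j : Fin (k + 1), ∃ v : ℝ → ℝ,
    HasWeakDeriv j u v ∧ MemLp v (ENNReal.ofReal p) (weight (α j))}
  add_mem' := by
    intro u u' hu hu' j
    obtain ⟨v, h1, h2⟩ := hu j
    obtain ⟨v', h1', h2'⟩ := hu' j
    exact ⟨v + v', (h1.add h1').congr (AEEqFun.coeFn_add u u').symm Filter.EventuallyEq.rfl,
      h2.add h2'⟩
  zero_mem' := by
    intro j
    exact ⟨0, (HasWeakDeriv.zero j).congr AEEqFun.coeFn_zero.symm Filter.EventuallyEq.rfl,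
      MemLp.zero⟩
  smul_mem' := by
    intro c u hu j
    obtain ⟨v, h1, h2⟩ := hu j
    exact ⟨c • v, (h1.smul c).congr (AEEqFun.coeFn_smul c u).symm Filter.EventuallyEq.rfl,
      h2.const_smul c⟩

/-- The weighted Sobolev space `X^{k,p}_∞(α₀, …, α_k)`; it is normed below. -/
def X (k : ℕ) (p : ℝ) (α : Fin (k + 1) → ℝ) : Type := carrier k p α

variable {k : ℕ} {p : ℝ} {α : Fin (k + 1) → ℝ}

noncomputable instance : AddCommGroup (X k p α) := inferInstanceAs (AddCommGroup (carrier k p α))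

noncomputable instance : Module ℝ (X k p α) := inferInstanceAs (Module ℝ (carrier k p α))

/-- The function on `(0, ∞)` underlying an element of `X^{k,p}_∞`. -/
def toFun0 (u : X k p α) : Fun0 := u.1

/-- The `j`-th weak derivative of `u`, as an element of `L^p_{α_j}`. -/
noncomputable def weakDeriv (u : X k p α) (j : Fin (k + 1)) : WLp p (α j) :=
  (u.2 j).choose_spec.2.toLp _

theorem hasWeakDeriv_weakDeriv (u : X k p α) (j : Fin (k + 1)) :
    HasWeakDeriv j (toFun0 u) (weakDeriv u j) :=
  (u.2 j).choose_spec.1.congr Filter.EventuallyEq.rfl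
    (Filter.EventuallyEq.symm
      ((ae_weight_iff (α j)).1 (MemLp.coeFn_toLp (u.2 j).choose_spec.2)))

theorem weakDeriv_eq {u : X k p α} {j : Fin (k + 1)} {w : WLp p (α j)}
    (h : HasWeakDeriv j (toFun0 u) w) : weakDeriv u j = w :=
  Lp.ext ((ae_weight_iff (α j)).2 ((hasWeakDeriv_weakDeriv u j).unique h))

theorem weakDeriv_add (u v : X k p α) (j : Fin (k + 1)) :
    weakDeriv (u + v) j = weakDeriv u j + weakDeriv v j :=
  weakDeriv_eq (((hasWeakDeriv_weakDeriv u j).add (hasWeakDeriv_weakDeriv v j)).congr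
    (AEEqFun.coeFn_add (toFun0 u) (toFun0 v)).symm
    ((ae_weight_iff (α j)).1 (Lp.coeFn_add _ _).symm))

theorem weakDeriv_smul (c : ℝ) (u : X k p α) (j : Fin (k + 1)) :
    weakDeriv (c • u) j = c • weakDeriv u j :=
  weakDeriv_eq (((hasWeakDeriv_weakDeriv u j).smul c).congr
    (AEEqFun.coeFn_smul c (toFun0 u)).symm
    ((ae_weight_iff (α j)).1 (Lp.coeFn_smul _ _).symm))

/-- The weak derivative of order `0` is the function itself. -/
theorem weakDeriv_zero_ae (u : X k p α) :
    weakDeriv u 0 =ᵐ[volume.restrict (Ioi 0)] toFun0 u := by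
  have h := hasWeakDeriv_weakDeriv u 0
  exact h.unique ⟨h.1, h.1, fun φ _ _ _ => by simp⟩

/-- The map `u ↦ (u, u', …, u⁽ᵏ⁾)` into the `ℓ^p`-product of the spaces `L^p_{α_j}`. -/
noncomputable def jet : X k p α →ₗ[ℝ] PiLp (ENNReal.ofReal p) (fun j => WLp p (α j)) where
  toFun u := WithLp.toLp _ (weakDeriv u)
  map_add' u v := by
    ext1 j
    exact weakDeriv_add u v j
  map_smul' c u := by
    ext1 j
    exact weakDeriv_smul c u j

theorem jet_injective : Function.Injective (jet (k := k) (p := p) (α := α)) := by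
  intro u v h
  have h0 : weakDeriv u 0 = weakDeriv v 0 := congrArg (fun f => f 0) h
  have : toFun0 u = toFun0 v := by
    refine AEEqFun.ext ((weakDeriv_zero_ae u).symm.trans ?_)
    rw [h0]
    exact weakDeriv_zero_ae v
  exact Subtype.ext this

noncomputable instance [Fact (1 ≤ p)] : NormedAddCommGroup (X k p α) :=
  NormedAddCommGroup.induced _ _ (jet (k := k) (p := p) (α := α)) jet_injective

noncomputable instance [Fact (1 ≤ p)] : NormedSpace ℝ (X k p α) :=
  NormedSpace.induced ℝ _ _ (jet (k := k) (p := p) (α := α))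

/-- The norm of `X^{k,p}_∞` is `(∑_{j=0}^k ‖u⁽ʲ⁾‖^p_{L^p_{α_j}})^{1/p}`. -/
theorem norm_eq [hp : Fact (1 ≤ p)] (u : X k p α) :
    ‖u‖ = (∑ j, ‖weakDeriv u j‖ ^ p) ^ (1 / p) := by
  have h0 : 0 < p := lt_of_lt_of_le one_pos hp.out
  have hr : (ENNReal.ofReal p).toReal = p := ENNReal.toReal_ofReal h0.le
  have h : ‖u‖ = ‖jet u‖ := rfl
  rw [h, PiLp.norm_eq_sum (by rw [hr]; exact h0), hr]
  rfl

/-- `X^{k,p}_∞(α₀, …, α_k) ↪ L^q_θ(0, ∞)`: the identity `u ↦ u` is a well-defined bounded linear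
map. -/
def ContinuouslyEmbeds (k : ℕ) (p : ℝ) [Fact (1 ≤ p)] (α : Fin (k + 1) → ℝ)
    (q : ℝ) [Fact (1 ≤ q)] (θ : ℝ) : Prop :=
  ∃ ι : X k p α →L[ℝ] WLp q θ, ∀ u, ι u =ᵐ[volume.restrict (Ioi 0)] toFun0 u

/-- The identity `u ↦ u` is a well-defined compact linear map from `X^{k,p}_∞(α₀, …, α_k)` to
`L^q_θ(0, ∞)`. -/
def CompactlyEmbeds (k : ℕ) (p : ℝ) [Fact (1 ≤ p)] (α : Fin (k + 1) → ℝ)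
    (q : ℝ) [Fact (1 ≤ q)] (θ : ℝ) : Prop :=
  ∃ ι : X k p α →L[ℝ] WLp q θ, (∀ u, ι u =ᵐ[volume.restrict (Ioi 0)] toFun0 u) ∧
    IsCompactOperator ι

/-- The critical exponent `p* = (θ + 1) p / (α_k - k p + 1)`. -/
noncomputable def criticalExponent (k : ℕ) (p : ℝ) (α : Fin (k + 1) → ℝ) (θ : ℝ) : ℝ :=
  (θ + 1) * p / (α (Fin.last k) - k * p + 1)

end WeightedSobolev

/-!
The proof reduces the space `X^{k,p}_∞` to first order and then argues with weighted integrals on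
`(0, ∞)`. Put `b = α_k - k p ≥ -1`.

*Reduction.* A function with a weak derivative is a.e. equal to a primitive of it
(`HasWeakDeriv.exists_isPrimitive`). Since `u⁽ʲ⁾ ∈ L^p_{α_j}` with `α_j ≥ -1`, it cannot stay away
from zero at infinity, and Hardy's inequality (`IsPrimitive.hardy`) passes from
`u⁽ʲ⁺¹⁾ ∈ L^p_{b + (j + 1) p}` to `u⁽ʲ⁾ ∈ L^p_{b + j p}` if `b + j p > -1`. Descending from
`j = k` gives `u' ∈ L^p_{b + p}`, and also `u ∈ L^p_b` if `b > -1`. So the unit ball lies in a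
class `energyClass p (α 0) b B` of primitives (`exists_mem_energyClass`).

*Pointwise bounds.* On `(x, x + h]` with `h ≤ x` power weights are comparable to constants, and
`IsPrimitive.enorm_rpow_le` bounds `|u(x)|` by the two weighted integrals. If `b > -1`, taking
`h = x` yields `|u(x)| ≤ M x ^ (-(b + 1) / p)`. In the limiting case `b = -1` the function is
bounded on `[1, ∞)`, decays like a power there if `p > 1` and `α_0 > -1` (take `h = x ^ s` with
`-α_0 < s < 1`), and grows more slowly than any power at the origin.

*Embedding.* Write `|u|^q r^θ = |u|^p |u|^(q - p) r^θ` and use the pointwise bound for the second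
factor: what remains is `|u|^p r^e`. For `b > -1`, `q ≤ p*` means `e ≥ b` and `θ ≤ α_0` gives
`e ≤ α_0`, so the integral over `(0, 1)` is controlled by the weight `r^b` and the one over
`(1, ∞)` by `r^{α_0}`. For `b = -1 < θ` the slow growth at the origin makes `|u|^q r^θ` integrable
there directly, and for `b = θ = α_0 = -1` the function is bounded.

*Compactness.* Strict inequalities for `e`, or in the limiting case slow growth at the origin and,
for `θ = α_0`, decay at infinity, make the mass near `0` and near `∞` uniformly small on the unit
ball (`SmallAtZero`, `SmallAtInfty`). On a compact interval cut into short pieces, `u` deviates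
from its mean on a piece by at most the integral of `|u'|` over it, so finitely many integrals of
`u` control the rest (`exists_wInt_Ioc_le_of_sum`), and `isCompactOperator_of_finite_rank_control`
applies.
-/

namespace WeightedSobolev

/-! ### Weak derivatives and primitives -/

/-- `U` is a primitive of the locally integrable function `V` on `(0, ∞)`; such a `U` is locally
absolutely continuous. -/
structure IsPrimitive (U V : ℝ → ℝ) : Prop where
  locallyIntegrableOn : LocallyIntegrableOn V (Ioi 0)
  sub_eq : ∀ x y, 0 < x → 0 < y → U y - U x = ∫ t in x..y, V t

theorem uIcc_subset_Ioi {x y : ℝ} (hx : 0 < x) (hy : 0 < y) : uIcc x y ⊆ Ioi 0 := by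
  intro z hz
  exact lt_of_lt_of_le (lt_min hx hy) hz.1

theorem intervalIntegrable_of_locallyIntegrableOn {V : ℝ → ℝ}
    (hV : LocallyIntegrableOn V (Ioi 0)) {x y : ℝ} (hx : 0 < x) (hy : 0 < y) :
    IntervalIntegrable V volume x y :=
  (hV.integrableOn_compact_subset (uIcc_subset_Ioi hx hy) isCompact_uIcc).intervalIntegrable

theorem isPrimitive_integral {V : ℝ → ℝ} (hV : LocallyIntegrableOn V (Ioi 0)) (c : ℝ) :
    IsPrimitive (fun x => (∫ t in (1 : ℝ)..x, V t) + c) V := by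
  refine ⟨hV, fun x y hx hy => ?_⟩
  rw [add_sub_add_right_eq_sub, intervalIntegral.integral_interval_sub_left]
  · exact intervalIntegrable_of_locallyIntegrableOn hV one_pos hy
  · exact intervalIntegrable_of_locallyIntegrableOn hV one_pos hx

theorem IsPrimitive.continuousOn {U V : ℝ → ℝ} (h : IsPrimitive U V) :
    ContinuousOn U (Ioi 0) := by
  intro x hx
  have hx0 : (0 : ℝ) < x := hx
  have hi := intervalIntegrable_of_locallyIntegrableOn h.locallyIntegrableOn
    (x := x / 2) (y := x + 1) (by positivity) (by positivity)
  have hc := (hi.absolutelyContinuousOnInterval_intervalIntegral (c := x / 2)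
    left_mem_uIcc).continuousOn
  have hnhds : uIcc (x / 2) (x + 1) ∈ nhds x := by
    rw [uIcc_of_le (by linarith)]
    exact Icc_mem_nhds (by linarith) (by linarith)
  have hc' := (hc.continuousAt hnhds).add (continuousAt_const (y := U (x / 2)))
  refine (hc'.congr ?_).continuousWithinAt
  filter_upwards [Ioi_mem_nhds hx0] with y hy
  have := h.sub_eq (x / 2) y (by positivity) hy
  simp only [Pi.add_apply]
  linarith

theorem exists_support_subset_Ioo {φ : ℝ → ℝ} (hc : HasCompactSupport φ)
    (hs : tsupport φ ⊆ Ioi 0) :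
    ∃ a b : ℝ, 0 < a ∧ a < 1 ∧ 1 < b ∧ tsupport φ ⊆ Ioo a b := by
  obtain ⟨B, hB⟩ := hc.bddAbove
  have hcl : ∃ a > 0, ∀ x ∈ tsupport φ, a < x := by
    rcases (tsupport φ).eq_empty_or_nonempty with h | h
    · exact ⟨1, one_pos, by simp [h]⟩
    · obtain ⟨m, hm, hmin⟩ := hc.exists_isLeast h
      have : (0 : ℝ) < m := hs hm
      exact ⟨m / 2, by positivity, fun x hx => by have := hmin hx; linarith⟩
  obtain ⟨a, ha, hax⟩ := hcl
  refine ⟨min a (1 / 2), max B 1 + 1, lt_min ha (by norm_num), ?_, ?_, fun x hx => ⟨?_, ?_⟩⟩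
  · exact (min_le_right _ _).trans_lt (by norm_num)
  · have := le_max_right B 1; linarith
  · exact (min_le_left _ _).trans_lt (hax x hx)
  · have := hB hx; have := le_max_left B 1; linarith

theorem setIntegral_Ioi_eq_interval {f : ℝ → ℝ} {a b : ℝ} (ha : 0 ≤ a) (hab : a ≤ b)
    (h : ∀ x, x ∉ Ioo a b → f x = 0) : ∫ r in Ioi 0, f r = ∫ r in a..b, f r := by
  rw [intervalIntegral.integral_of_le hab]
  refine setIntegral_eq_of_subset_of_forall_sdiff_eq_zero measurableSet_Ioi ?_ ?_
  · exact fun x hx => lt_of_le_of_lt ha hx.1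
  · exact fun x hx => h x fun hx' => hx.2 ⟨hx'.1, hx'.2.le⟩

/-- Integration by parts for a primitive against a test function. -/
theorem integral_primitive_mul_deriv {V φ : ℝ → ℝ} (hV : LocallyIntegrableOn V (Ioi 0))
    (hφ : ContDiff ℝ ∞ φ) (hc : HasCompactSupport φ) (hs : tsupport φ ⊆ Ioi 0) :
    ∫ r in Ioi 0, (∫ t in (1 : ℝ)..r, V t) * deriv φ r = -∫ r in Ioi 0, V r * φ r := by
  obtain ⟨a, b, ha, ha1, hb1, hab⟩ := exists_support_subset_Ioo hc hs
  have hle : a ≤ b := by linarith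
  have hφ0 : ∀ x, x ∉ Ioo a b → φ x = 0 := fun x hx =>
    image_eq_zero_of_notMem_tsupport fun h => hx (hab h)
  have hφ1 : ∀ x, x ∉ Ioo a b → deriv φ x = 0 := fun x hx =>
    Function.notMem_support.1 fun h => hx (hab (support_deriv_subset h))
  have hi := intervalIntegrable_of_locallyIntegrableOn hV ha (by linarith : 0 < b)
  have hm : (1 : ℝ) ∈ uIcc a b := by rw [uIcc_of_le hle]; exact ⟨ha1.le, hb1.le⟩
  have hac := hi.absolutelyContinuousOnInterval_intervalIntegral hm
  have hφac : AbsolutelyContinuousOnInterval φ a b :=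
    ((hφ.of_le (by simp) : ContDiff ℝ 1 φ).contDiffOn).absolutelyContinuousOnInterval
  rw [setIntegral_Ioi_eq_interval ha.le hle (fun x hx => by rw [hφ1 x hx, mul_zero]),
    setIntegral_Ioi_eq_interval ha.le hle (fun x hx => by rw [hφ0 x hx, mul_zero]),
    hac.integral_mul_deriv_eq_deriv_mul hφac, hφ0 a (by simp), hφ0 b (by simp)]
  have : ∫ x in a..b, deriv (fun x => ∫ v in (1 : ℝ)..x, V v) x * φ x =
      ∫ x in a..b, V x * φ x := by
    refine intervalIntegral.integral_congr_ae ?_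
    filter_upwards [hi.ae_hasDerivAt_integral] with x hx hx'
    rw [(hx (uIoc_subset_uIcc hx') 1 hm).deriv]
  rw [this]
  ring

/-- A function on the half-line whose weak derivative vanishes is constant. -/
theorem ae_eq_const_of_integral_deriv_eq_zero {w : ℝ → ℝ} (hw : LocallyIntegrableOn w (Ioi 0))
    (h : ∀ φ : ℝ → ℝ, ContDiff ℝ ∞ φ → HasCompactSupport φ → tsupport φ ⊆ Ioi 0 →
      ∫ r in Ioi 0, w r * deriv φ r = 0) :
    ∃ c : ℝ, w =ᵐ[volume.restrict (Ioi 0)] fun _ => c := by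
  let ψ₀ : ContDiffBump (1 : ℝ) := ⟨1 / 4, 1 / 2, by norm_num, by norm_num⟩
  let ψ : ℝ → ℝ := ψ₀.normed volume
  have hψ : ContDiff ℝ ∞ ψ := ψ₀.contDiff_normed
  have hψc : HasCompactSupport ψ := ψ₀.hasCompactSupport_normed
  have hψs : tsupport ψ ⊆ Ioi 0 := by
    rw [ψ₀.tsupport_normed_eq]
    intro x hx
    have h2 : |x - 1| ≤ 1 / 2 := hx
    have := (abs_le.1 h2).1
    simp only [mem_Ioi]; linarith
  have hψ1 : ∫ x, ψ x = 1 := ψ₀.integral_normed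
  refine ⟨∫ r in Ioi 0, w r * ψ r, ?_⟩
  set c := ∫ r in Ioi 0, w r * ψ r
  have key : ∀ᵐ r ∂(volume : Measure ℝ), r ∈ Ioi (0 : ℝ) → (w - (fun _ => c : ℝ → ℝ)) r = 0 := by
    refine isOpen_Ioi.ae_eq_zero_of_integral_contDiff_smul_eq_zero
      (hw.sub ((locallyIntegrable_const c).locallyIntegrableOn _)) ?_
    intro φ h1 h2 h3
    set d := ∫ x, φ x with hd
    -- `g` has mean zero, so its primitive is again a test function.
    let g : ℝ → ℝ := fun x => φ x - d * ψ x
    have hg : ContDiff ℝ ∞ g := h1.sub (contDiff_const.mul hψ)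
    have hgc : HasCompactSupport g := h2.sub (hψc.mul_left)
    have hgs : tsupport g ⊆ Ioi 0 := by
      refine (tsupport_sub φ (fun x => d * ψ x)).trans (union_subset h3 ?_)
      exact (tsupport_mul_subset_right (f := fun _ => d) (g := ψ)).trans hψs
    obtain ⟨a, b, ha, ha1, hb1, hab⟩ := exists_support_subset_Ioo hgc hgs
    have hg0 : ∀ x, x ∉ Ioo a b → g x = 0 := fun x hx =>
      image_eq_zero_of_notMem_tsupport fun h => hx (hab h)
    have hgint : ∫ x, g x = 0 := by
      have : ∫ x, g x = d - d * 1 := by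
        rw [← hψ1, hd, ← integral_const_mul]
        refine integral_sub (h1.continuous.integrable_of_hasCompactSupport h2) ?_
        exact (hψ.continuous.integrable_of_hasCompactSupport hψc).const_mul _
      rw [this]; ring
    have hgab : ∫ x in a..b, g x = 0 := by
      rw [← hgint, intervalIntegral.integral_of_le (by linarith)]
      refine setIntegral_eq_integral_of_forall_compl_eq_zero fun x hx => hg0 x fun hx' => ?_
      exact hx ⟨hx'.1, hx'.2.le⟩
    let χ : ℝ → ℝ := fun x => ∫ t in a..x, g t
    have hχd : ∀ x, HasDerivAt χ (g x) x := fun x =>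
      intervalIntegral.integral_hasDerivAt_right (hg.continuous.intervalIntegrable _ _)
        hg.continuous.aestronglyMeasurable.stronglyMeasurableAtFilter hg.continuous.continuousAt
    have hχ' : deriv χ = g := funext fun x => (hχd x).deriv
    have hχ : ContDiff ℝ ∞ χ :=
      contDiff_infty_iff_deriv.2 ⟨fun x => (hχd x).differentiableAt, hχ' ▸ hg⟩
    have hχ0 : ∀ x, x ∉ Icc a b → χ x = 0 := by
      intro x hx
      rw [mem_Icc, not_and_or, not_le, not_le] at hx
      rcases hx with hx | hx
      · refine intervalIntegral.integral_zero_ae (Filter.Eventually.of_forall fun t ht => ?_)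
        rw [uIoc_of_ge hx.le] at ht
        exact hg0 t fun h => absurd h.1 (not_lt.2 ht.2)
      · have e := intervalIntegral.integral_add_adjacent_intervals
          (hg.continuous.intervalIntegrable (μ := volume) a b)
          (hg.continuous.intervalIntegrable (μ := volume) b x)
        have e2 : ∫ t in b..x, g t = 0 := by
          refine intervalIntegral.integral_zero_ae (Filter.Eventually.of_forall fun t ht => ?_)
          rw [uIoc_of_le hx.le] at ht
          exact hg0 t fun h => absurd h.2 (not_lt.2 ht.1.le)
        rw [hgab, e2, add_zero] at e
        exact e.symm
    have hχs : tsupport χ ⊆ Icc a b :=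
      closure_minimal (fun x hx => by_contra fun h => hx (hχ0 x h)) isClosed_Icc
    have hχc : HasCompactSupport χ := HasCompactSupport.of_support_subset_isCompact isCompact_Icc
      ((subset_tsupport _).trans hχs)
    have hz := h χ hχ hχc (hχs.trans fun x hx => lt_of_lt_of_le ha hx.1)
    rw [hχ'] at hz
    have i1 := integrableOn_mul hw h1.continuous h2 h3
    have i2 := integrableOn_mul hw hψ.continuous hψc hψs
    have e1 : ∫ r in Ioi 0, w r * g r = (∫ r in Ioi 0, w r * φ r) - d * c := by
      rw [← integral_const_mul, ← integral_sub i1 (i2.const_mul d)]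
      refine integral_congr_ae (Filter.Eventually.of_forall fun r => ?_)
      simp only [g]; ring
    have e3 : ∀ f : ℝ → ℝ, ∫ r, φ r * f r = ∫ r in Ioi 0, φ r * f r := by
      intro f
      refine (setIntegral_eq_integral_of_forall_compl_eq_zero fun r hr => ?_).symm
      have : φ r = 0 := image_eq_zero_of_notMem_tsupport fun h => hr (h3 h)
      simp [this]
    have e4 : d = ∫ r in Ioi 0, φ r := by
      have := e3 fun _ => 1
      simpa using this
    have i3 : IntegrableOn φ (Ioi 0) :=
      (h1.continuous.integrable_of_hasCompactSupport h2).integrableOn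
    have e2 : ∫ r, φ r • (w - (fun _ => c : ℝ → ℝ)) r = (∫ r in Ioi 0, w r * φ r) - d * c := by
      simp only [smul_eq_mul]
      rw [e3, e4, mul_comm _ c, ← integral_const_mul, ← integral_sub i1 (i3.const_mul c)]
      refine integral_congr_ae (Filter.Eventually.of_forall fun r => ?_)
      simp only [Pi.sub_apply]; ring
    rw [e2, ← e1, hz]
  rw [Filter.EventuallyEq, ae_restrict_iff' measurableSet_Ioi]
  filter_upwards [key] with r hr h0
  exact sub_eq_zero.1 (hr h0)

/-- A function with a first weak derivative `v` has a locally absolutely continuous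
representative, a primitive of `v`. -/
theorem HasWeakDeriv.exists_isPrimitive {u v : ℝ → ℝ} (h : HasWeakDeriv 1 u v) :
    ∃ U, IsPrimitive U v ∧ U =ᵐ[volume.restrict (Ioi 0)] u := by
  have hv := h.2.1
  have hW : LocallyIntegrableOn (fun x => ∫ t in (1 : ℝ)..x, v t) (Ioi 0) := by
    have := (isPrimitive_integral hv 0).continuousOn
    simp only [add_zero] at this
    exact this.locallyIntegrableOn measurableSet_Ioi
  obtain ⟨c, hc⟩ := ae_eq_const_of_integral_deriv_eq_zero (h.1.sub hW) (by
    intro φ h1 h2 h3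
    have h4 := h.2.2 φ h1 h2 h3
    have h5 := integral_primitive_mul_deriv hv h1 h2 h3
    have j1 := integrableOn_mul_iteratedDeriv h.1 h1 h2 h3 1
    have j2 := integrableOn_mul_iteratedDeriv hW h1 h2 h3 1
    rw [iteratedDeriv_one] at h4 j1 j2
    simp only [Pi.sub_apply, sub_mul]
    rw [integral_sub j1 j2, h4, h5]
    ring)
  refine ⟨_, isPrimitive_integral hv c, ?_⟩
  filter_upwards [hc] with x hx
  simp only [Pi.sub_apply] at hx
  linarith

theorem HasWeakDeriv.of_succ {j : ℕ} {u v w : ℝ → ℝ} (hv : HasWeakDeriv j u v)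
    (hw : HasWeakDeriv (j + 1) u w) : HasWeakDeriv 1 v w := by
  refine ⟨hv.2.1, hw.2.1, fun φ h1 h2 h3 => ?_⟩
  have hd : ContDiff ℝ ∞ (deriv φ) := (contDiff_infty_iff_deriv.1 h1).2
  have e1 := hv.2.2 (deriv φ) hd h2.deriv
    ((closure_minimal support_deriv_subset (isClosed_tsupport _)).trans h3)
  have e2 := hw.2.2 φ h1 h2 h3
  rw [← iteratedDeriv_succ', e2, pow_succ] at e1
  rw [iteratedDeriv_one]
  have : ((-1 : ℝ) ^ j) ≠ 0 := pow_ne_zero _ (by norm_num)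
  refine mul_left_cancel₀ this ?_
  rw [← e1]
  ring

/-! ### Weighted integrals and Hardy's inequality -/

/-- The weighted integral `∫_S |f|^p r^a dr`, as an extended nonnegative real. -/
noncomputable def wInt (p a : ℝ) (S : Set ℝ) (f : ℝ → ℝ) : ℝ≥0∞ :=
  ∫⁻ r in S, ‖f r‖ₑ ^ p * ENNReal.ofReal (r ^ a)

theorem lintegral_Ioi_rpow {a c : ℝ} (ha : a < -1) (hc : 0 < c) :
    ∫⁻ s in Ioi c, ENNReal.ofReal (s ^ a) = ENNReal.ofReal (-c ^ (a + 1) / (a + 1)) := by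
  rw [← integral_Ioi_rpow_of_lt ha hc]
  refine (ofReal_integral_eq_lintegral_ofReal (integrableOn_Ioi_rpow_of_lt ha hc) ?_).symm
  filter_upwards [ae_restrict_mem measurableSet_Ioi] with s hs
  exact Real.rpow_nonneg (hc.le.trans (le_of_lt hs)) a

theorem lintegral_Ioc_rpow {a c : ℝ} (ha : -1 < a) (hc : 0 ≤ c) :
    ∫⁻ s in Ioc 0 c, ENNReal.ofReal (s ^ a) = ENNReal.ofReal (c ^ (a + 1) / (a + 1)) := by
  have h1 : ∫ s in Ioc 0 c, s ^ a = c ^ (a + 1) / (a + 1) := by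
    rw [← intervalIntegral.integral_of_le hc, integral_rpow (Or.inl ha),
      Real.zero_rpow (by linarith), sub_zero]
  rw [← h1]
  refine (ofReal_integral_eq_lintegral_ofReal ?_ ?_).symm
  · have := intervalIntegral.intervalIntegrable_rpow' (a := 0) (b := c) ha
    exact (intervalIntegrable_iff_integrableOn_Ioc_of_le hc).1 this
  · filter_upwards [ae_restrict_mem measurableSet_Ioc] with s hs
    exact Real.rpow_nonneg hs.1.le a

theorem lintegral_Ioi_rpow_eq_top {a c : ℝ} (ha : -1 ≤ a) (hc : 0 < c) :
    ∫⁻ s in Ioi c, ENNReal.ofReal (s ^ a) = ⊤ := by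
  by_contra h
  have h2 : IntegrableOn (fun s : ℝ => s ^ a) (Ioi c) := by
    refine ⟨(by fun_prop : Measurable fun s : ℝ => s ^ a).aestronglyMeasurable, ?_⟩
    rw [hasFiniteIntegral_iff_ofReal]
    · exact lt_top_iff_ne_top.2 h
    · filter_upwards [ae_restrict_mem measurableSet_Ioi] with s hs
      exact Real.rpow_nonneg (hc.le.trans (le_of_lt hs)) a
  have := (integrableOn_Ioi_rpow_iff hc).1 h2
  linarith

/-- Jensen's inequality for the power `p` and a measure that need not have mass one. -/
theorem lintegral_rpow_le {γ : Type*} [MeasurableSpace γ] {ν : Measure γ} {f : γ → ℝ≥0∞}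
    (hf : AEMeasurable f ν) {p : ℝ} (hp : 1 ≤ p) :
    (∫⁻ x, f x ∂ν) ^ p ≤ ν univ ^ (p - 1) * ∫⁻ x, f x ^ p ∂ν := by
  have h0 : 0 < p := by linarith
  have h := eLpNorm'_le_eLpNorm'_mul_rpow_measure_univ one_pos hp hf.aestronglyMeasurable
  simp only [eLpNorm', enorm_eq_self, ENNReal.rpow_one, div_one] at h
  refine (ENNReal.rpow_le_rpow h h0.le).trans_eq ?_
  rw [ENNReal.mul_rpow_of_nonneg _ _ h0.le, ← ENNReal.rpow_mul, ← ENNReal.rpow_mul,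
    one_div_mul_cancel h0.ne', ENNReal.rpow_one, mul_comm]
  congr 2
  field_simp

theorem ofReal_rpow_mul_ofReal_rpow {s : ℝ} (hs : 0 < s) (a b : ℝ) :
    ENNReal.ofReal (s ^ a) * ENNReal.ofReal (s ^ b) = ENNReal.ofReal (s ^ (a + b)) := by
  rw [← ENNReal.ofReal_mul (Real.rpow_nonneg hs.le a), Real.rpow_add hs]

theorem ofReal_rpow_rpow {s : ℝ} (hs : 0 < s) (a b : ℝ) :
    ENNReal.ofReal (s ^ a) ^ b = ENNReal.ofReal (s ^ (a * b)) := by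
  rw [ENNReal.ofReal_rpow_of_pos (Real.rpow_pos_of_pos hs a), Real.rpow_mul hs.le]

/-- Jensen's inequality on `(r, ∞)` for the finite measure `s ^ (-σ) ds`, `σ > 1`. It takes the place
of Hölder's inequality with the conjugate exponent, and includes `p = 1`. -/
theorem lintegral_Ioi_rpow_le {F : ℝ → ℝ≥0∞} {r σ p : ℝ} (hr : 0 < r) (hσ : 1 < σ) (hp : 1 ≤ p)
    (hF : AEMeasurable F (volume.restrict (Ioi r))) :
    (∫⁻ s in Ioi r, F s) ^ p ≤ ENNReal.ofReal (r ^ (1 - σ) / (σ - 1)) ^ (p - 1) *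
      ∫⁻ s in Ioi r, F s ^ p * ENNReal.ofReal (s ^ (σ * (p - 1))) := by
  have h0 : 0 < p := by linarith
  have hm : ∀ b : ℝ, Measurable fun s : ℝ => ENNReal.ofReal (s ^ b) := fun b => by fun_prop
  set ν := (volume.restrict (Ioi r)).withDensity (fun s => ENNReal.ofReal (s ^ (-σ))) with hν
  have hac : ν ≪ volume.restrict (Ioi r) := withDensity_absolutelyContinuous _ _
  have hG : AEMeasurable (fun s => F s * ENNReal.ofReal (s ^ σ)) (volume.restrict (Ioi r)) :=
    hF.mul (hm σ).aemeasurable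
  have e1 : ∫⁻ s in Ioi r, F s = ∫⁻ s, F s * ENNReal.ofReal (s ^ σ) ∂ν := by
    rw [hν, lintegral_withDensity_eq_lintegral_mul₀ (hm _).aemeasurable hG]
    refine setLIntegral_congr_fun measurableSet_Ioi fun s hs => ?_
    have hs0 : 0 < s := hr.trans hs
    simp only [Pi.mul_apply]
    rw [mul_left_comm, ofReal_rpow_mul_ofReal_rpow hs0]
    simp
  have e2 : ∫⁻ s, (F s * ENNReal.ofReal (s ^ σ)) ^ p ∂ν =
      ∫⁻ s in Ioi r, F s ^ p * ENNReal.ofReal (s ^ (σ * (p - 1))) := by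
    rw [hν, lintegral_withDensity_eq_lintegral_mul₀ (hm _).aemeasurable (hG.pow_const p)]
    refine setLIntegral_congr_fun measurableSet_Ioi fun s hs => ?_
    have hs0 : 0 < s := hr.trans hs
    simp only [Pi.mul_apply]
    rw [ENNReal.mul_rpow_of_nonneg _ _ h0.le, mul_left_comm, ofReal_rpow_rpow hs0,
      ofReal_rpow_mul_ofReal_rpow hs0]
    congr 3
    ring
  have e3 : ν univ = ENNReal.ofReal (r ^ (1 - σ) / (σ - 1)) := by
    rw [hν, withDensity_apply _ MeasurableSet.univ, Measure.restrict_univ,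
      lintegral_Ioi_rpow (by linarith) hr]
    congr 1
    rw [neg_add_eq_sub, ← neg_sub σ 1, div_neg, neg_div, neg_neg]
  rw [e1, ← e2, ← e3]
  exact lintegral_rpow_le (hG.mono_ac hac) hp

theorem IsPrimitive.aemeasurable {U V : ℝ → ℝ} (h : IsPrimitive U V) :
    AEMeasurable V (volume.restrict (Ioi 0)) :=
  h.locallyIntegrableOn.aestronglyMeasurable.aemeasurable

theorem IsPrimitive.enorm_sub_le {U V : ℝ → ℝ} (h : IsPrimitive U V) {x y : ℝ} (hx : 0 < x)
    (hxy : x ≤ y) : ‖U x - U y‖ₑ ≤ ∫⁻ t in Ioc x y, ‖V t‖ₑ := by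
  rw [← neg_sub, enorm_neg, h.sub_eq x y hx (hx.trans_le hxy), intervalIntegral.integral_of_le hxy]
  exact enorm_integral_le_lintegral_enorm _

theorem IsPrimitive.enorm_le {U V : ℝ → ℝ} (h : IsPrimitive U V) {x y : ℝ} (hx : 0 < x)
    (hxy : x ≤ y) : ‖U x‖ₑ ≤ ‖U y‖ₑ + ∫⁻ t in Ioc x y, ‖V t‖ₑ := by
  have e : U x = U y + (U x - U y) := by ring
  calc ‖U x‖ₑ = ‖U y + (U x - U y)‖ₑ := by rw [← e]
    _ ≤ ‖U y‖ₑ + ‖U x - U y‖ₑ := enorm_add_le _ _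
    _ ≤ _ := by gcongr; exact h.enorm_sub_le hx hxy

/-- Integrability of `|U|^p r^b` with `b ≥ -1` forces `U` to come close to zero near infinity, so
that `U` is controlled by the integral of its derivative over `(r, ∞)`. -/
theorem IsPrimitive.enorm_le_lintegral_Ioi {U V : ℝ → ℝ} (h : IsPrimitive U V) {p b : ℝ}
    (hp : 0 < p) (hb : -1 ≤ b) (hU : wInt p b (Ioi 0) U ≠ ⊤) {r : ℝ} (hr : 0 < r) :
    ‖U r‖ₑ ≤ ∫⁻ t in Ioi r, ‖V t‖ₑ := by
  by_contra! hlt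
  set A := ∫⁻ t in Ioi r, ‖V t‖ₑ
  have hc : 0 < ‖U r‖ₑ - A := tsub_pos_of_lt hlt
  have hy : ∀ y ∈ Ioi r, ‖U r‖ₑ - A ≤ ‖U y‖ₑ := by
    intro y hy
    rw [tsub_le_iff_right]
    refine (h.enorm_le hr (le_of_lt hy)).trans ?_
    gcongr
    exact lintegral_mono_set Ioc_subset_Ioi_self
  refine hU (top_le_iff.1 ?_)
  calc (⊤ : ℝ≥0∞) = (‖U r‖ₑ - A) ^ p * ∫⁻ s in Ioi r, ENNReal.ofReal (s ^ b) := by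
        rw [lintegral_Ioi_rpow_eq_top hb hr, ENNReal.mul_top]
        exact (ENNReal.rpow_pos hc (by simp)).ne'
    _ = ∫⁻ s in Ioi r, (‖U r‖ₑ - A) ^ p * ENNReal.ofReal (s ^ b) := by
        rw [lintegral_const_mul]
        fun_prop
    _ ≤ ∫⁻ s in Ioi r, ‖U s‖ₑ ^ p * ENNReal.ofReal (s ^ b) := by
        refine setLIntegral_mono' measurableSet_Ioi fun s hs => ?_
        gcongr
        exact hy s hs
    _ ≤ wInt p b (Ioi 0) U := lintegral_mono_set (Ioi_subset_Ioi hr.le)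

/-- Tonelli's theorem on the triangle `0 < r < s`. -/
theorem lintegral_lintegral_triangle {F : ℝ → ℝ≥0∞} (hF : Measurable F) {G : ℝ → ℝ≥0∞}
    (hG : Measurable G) :
    ∫⁻ r in Ioi (0 : ℝ), G r * ∫⁻ s in Ioi r, F s =
      ∫⁻ s in Ioi (0 : ℝ), F s * ∫⁻ r in Ioo 0 s, G r := by
  have hT : MeasurableSet {z : ℝ × ℝ | 0 < z.1 ∧ z.1 < z.2} :=
    (measurableSet_lt measurable_const measurable_fst).inter
      (measurableSet_lt measurable_fst measurable_snd)
  let H : ℝ → ℝ → ℝ≥0∞ := fun r s =>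
    {z : ℝ × ℝ | 0 < z.1 ∧ z.1 < z.2}.indicator (fun z => G z.1 * F z.2) (r, s)
  have hH : Measurable (Function.uncurry H) :=
    ((hG.comp measurable_fst).mul (hF.comp measurable_snd)).indicator hT
  have e1 : ∫⁻ r in Ioi (0 : ℝ), G r * ∫⁻ s in Ioi r, F s = ∫⁻ r, ∫⁻ s, H r s := by
    rw [← lintegral_indicator measurableSet_Ioi]
    refine lintegral_congr fun r => ?_
    by_cases hr : r ∈ Ioi (0 : ℝ)
    · rw [indicator_of_mem hr, ← lintegral_const_mul _ hF, ← lintegral_indicator measurableSet_Ioi]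
      refine lintegral_congr fun s => ?_
      have hr' : 0 < r := hr
      simp [H, indicator, hr']
    · rw [indicator_of_notMem hr]
      have hr' : ¬ 0 < r := hr
      simp [H, indicator, hr']
  have e2 : ∫⁻ s in Ioi (0 : ℝ), F s * ∫⁻ r in Ioo 0 s, G r = ∫⁻ s, ∫⁻ r, H r s := by
    rw [← lintegral_indicator measurableSet_Ioi]
    refine lintegral_congr fun s => ?_
    by_cases hs : s ∈ Ioi (0 : ℝ)
    · rw [indicator_of_mem hs, ← lintegral_const_mul _ hG, ← lintegral_indicator measurableSet_Ioo]
      refine lintegral_congr fun r => ?_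
      simp [H, indicator, mul_comm]
    · rw [indicator_of_notMem hs]
      have hs' : s ≤ 0 := not_lt.1 hs
      have : ∀ r, H r s = 0 := fun r => by
        simp only [H, indicator, mem_ofPred_eq]
        rw [if_neg]
        rintro ⟨h1, h2⟩
        linarith
      simp [this]
  rw [e1, e2, lintegral_lintegral_swap hH.aemeasurable]

/-- Hardy's inequality for the tail integral of a nonnegative function. -/
theorem lintegral_tail_hardy {p a : ℝ} (hp : 1 ≤ p) (ha : p - 1 < a) :
    ∃ C : ℝ≥0∞, C ≠ ⊤ ∧ ∀ F : ℝ → ℝ≥0∞, Measurable F →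
      ∫⁻ r in Ioi (0 : ℝ), (∫⁻ s in Ioi r, F s) ^ p * ENNReal.ofReal (r ^ (a - p)) ≤
        C * ∫⁻ s in Ioi (0 : ℝ), F s ^ p * ENNReal.ofReal (s ^ a) := by
  -- `σ > 1` has to satisfy `(σ - 1) (p - 1) < a - p + 1`.
  set t := (a - p + 1) / (2 * p) with ht
  have h0 : 0 < p := by linarith
  have ht0 : 0 < t := by rw [ht]; apply div_pos <;> linarith
  have htp : t * (2 * p) = a - p + 1 := by rw [ht]; field_simp
  set σ := 1 + t
  have hexp : -1 < (1 - σ) * (p - 1) + (a - p) := by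
    have : t * (p - 1) < a - p + 1 := by nlinarith
    simp only [σ]; linarith
  set d := (1 - σ) * (p - 1) + (a - p) with hd
  have hm : ∀ b : ℝ, Measurable fun s : ℝ => ENNReal.ofReal (s ^ b) := fun b => by fun_prop
  refine ⟨ENNReal.ofReal (1 / (σ - 1)) ^ (p - 1) * ENNReal.ofReal (1 / (d + 1)), ?_, ?_⟩
  · exact ENNReal.mul_ne_top (ENNReal.rpow_ne_top_of_nonneg (by linarith) ENNReal.ofReal_ne_top)
      ENNReal.ofReal_ne_top
  intro F hF
  have hFm : Measurable fun s => F s ^ p * ENNReal.ofReal (s ^ (σ * (p - 1))) :=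
    (hF.pow_const p).mul (hm _)
  calc ∫⁻ r in Ioi (0 : ℝ), (∫⁻ s in Ioi r, F s) ^ p * ENNReal.ofReal (r ^ (a - p))
      ≤ ∫⁻ r in Ioi (0 : ℝ), ENNReal.ofReal (1 / (σ - 1)) ^ (p - 1) * (ENNReal.ofReal (r ^ d) *
          ∫⁻ s in Ioi r, F s ^ p * ENNReal.ofReal (s ^ (σ * (p - 1)))) := by
        refine setLIntegral_mono' measurableSet_Ioi fun r hr => ?_
        have hr0 : 0 < r := hr
        have hK := lintegral_Ioi_rpow_le (σ := σ) hr0 (by simp only [σ]; linarith) hp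
          hF.aemeasurable
        have e : ENNReal.ofReal (r ^ (1 - σ) / (σ - 1)) ^ (p - 1) =
            ENNReal.ofReal (1 / (σ - 1)) ^ (p - 1) * ENNReal.ofReal (r ^ ((1 - σ) * (p - 1))) := by
          rw [div_eq_mul_one_div, mul_comm, ENNReal.ofReal_mul (by simp only [σ]; simp [ht0.le]),
            ENNReal.mul_rpow_of_nonneg _ _ (by linarith), ofReal_rpow_rpow hr0]
        rw [e] at hK
        calc _ ≤ _ := mul_le_mul_left hK _
          _ = _ := by
            rw [hd, ← ofReal_rpow_mul_ofReal_rpow hr0 _ (a - p)]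
            ring
    _ = ENNReal.ofReal (1 / (σ - 1)) ^ (p - 1) * ∫⁻ s in Ioi (0 : ℝ),
          (F s ^ p * ENNReal.ofReal (s ^ (σ * (p - 1)))) *
            ∫⁻ r in Ioo 0 s, ENNReal.ofReal (r ^ d) := by
        rw [lintegral_const_mul', lintegral_lintegral_triangle hFm (hm d)]
        exact ENNReal.rpow_ne_top_of_nonneg (by linarith) ENNReal.ofReal_ne_top
    _ = ENNReal.ofReal (1 / (σ - 1)) ^ (p - 1) * ∫⁻ s in Ioi (0 : ℝ),
          ENNReal.ofReal (1 / (d + 1)) * (F s ^ p * ENNReal.ofReal (s ^ a)) := by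
        congr 1
        refine setLIntegral_congr_fun measurableSet_Ioi fun s hs => ?_
        have hs0 : 0 < s := hs
        have hsa : σ * (p - 1) + (d + 1) = a := by rw [hd]; ring
        rw [setLIntegral_congr Ioo_ae_eq_Ioc, lintegral_Ioc_rpow hexp hs0.le,
          div_eq_mul_one_div, ENNReal.ofReal_mul (Real.rpow_nonneg hs0.le _), ← hsa,
          ← ofReal_rpow_mul_ofReal_rpow hs0 _ (d + 1)]
        ring
    _ = _ := by
        rw [lintegral_const_mul' _ _ ENNReal.ofReal_ne_top, mul_assoc]

/-- **Hardy's inequality** on the half-line, for functions that are small at infinity. -/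
theorem IsPrimitive.hardy {p a : ℝ} (hp : 1 ≤ p) (ha : p - 1 < a) :
    ∃ C : ℝ≥0∞, C ≠ ⊤ ∧ ∀ (U V : ℝ → ℝ) (b : ℝ), IsPrimitive U V → -1 ≤ b →
      wInt p b (Ioi 0) U ≠ ⊤ → wInt p (a - p) (Ioi 0) U ≤ C * wInt p a (Ioi 0) V := by
  obtain ⟨C, hC, h⟩ := lintegral_tail_hardy hp ha
  refine ⟨C, hC, fun U V b hUV hb hU => ?_⟩
  have hVm := hUV.aemeasurable.enorm
  set F := hVm.mk
  have hF : (fun s => ‖V s‖ₑ) =ᵐ[volume.restrict (Ioi 0)] F := hVm.ae_eq_mk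
  have e : wInt p a (Ioi 0) V = ∫⁻ s in Ioi (0 : ℝ), F s ^ p * ENNReal.ofReal (s ^ a) := by
    refine lintegral_congr_ae ?_
    filter_upwards [hF] with s hs
    rw [hs]
  rw [e]
  refine le_trans ?_ (h F hVm.measurable_mk)
  refine setLIntegral_mono' measurableSet_Ioi fun r hr => ?_
  have hr0 : 0 < r := hr
  have := hUV.enorm_le_lintegral_Ioi (by linarith) hb hU hr0
  have e2 : ∫⁻ t in Ioi r, ‖V t‖ₑ = ∫⁻ t in Ioi r, F t :=
    lintegral_congr_ae (ae_restrict_of_ae_restrict_of_subset (Ioi_subset_Ioi hr0.le) hF)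
  rw [e2] at this
  gcongr

/-! ### Pointwise bounds -/

/-- On `[x, 2x]` the weight `y ^ a` is at least `2 ^ (-|a|) x ^ a`. -/
theorem rpow_weight_le {x y a : ℝ} (hx : 0 < x) (hxy : x ≤ y) (hy : y ≤ 2 * x) :
    1 ≤ 2 ^ |a| * x ^ (-a) * y ^ a := by
  have hy0 : 0 < y := hx.trans_le hxy
  have h1 : 1 ≤ y / x := (one_le_div hx).2 hxy
  have h2 : y / x ≤ 2 := (div_le_iff₀ hx).2 hy
  have e : x ^ (-a) * y ^ a = (y / x) ^ a := by
    rw [Real.div_rpow hy0.le hx.le, Real.rpow_neg hx.le]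
    field_simp
  have e2 : (y / x) ^ (-a) ≤ 2 ^ |a| :=
    (Real.rpow_le_rpow_of_exponent_le h1 (neg_le_abs a)).trans
      (Real.rpow_le_rpow (by linarith) h2 (abs_nonneg a))
  have h3 : 0 < (y / x) ^ a := Real.rpow_pos_of_pos (by linarith) a
  rw [Real.rpow_neg (by linarith), inv_le_iff_one_le_mul₀ h3] at e2
  rw [mul_assoc, e]
  linarith

theorem lintegral_Ioc_le_wInt {f : ℝ → ℝ} {x h a : ℝ} (p : ℝ) (hx : 0 < x) (hhx : h ≤ x) :
    ∫⁻ y in Ioc x (x + h), ‖f y‖ₑ ^ p ≤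
      ENNReal.ofReal (2 ^ |a| * x ^ (-a)) * wInt p a (Ioi 0) f := by
  rw [wInt, ← lintegral_const_mul' _ _ ENNReal.ofReal_ne_top]
  refine le_trans ?_ (lintegral_mono_set (fun y hy => hx.trans hy.1 : Ioc x (x + h) ⊆ Ioi 0))
  refine setLIntegral_mono' measurableSet_Ioc fun y hy => ?_
  have h1 := rpow_weight_le (a := a) hx hy.1.le (by linarith [hy.2])
  have h2 : 1 ≤ ENNReal.ofReal (2 ^ |a| * x ^ (-a)) * ENNReal.ofReal (y ^ a) := by
    rw [← ENNReal.ofReal_mul (by positivity)]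
    simpa using ENNReal.ofReal_le_ofReal h1
  calc ‖f y‖ₑ ^ p = 1 * ‖f y‖ₑ ^ p := (one_mul _).symm
    _ ≤ _ := mul_le_mul_left h2 _
    _ = _ := by ring

/-- Local bound for a primitive on an interval `(x, x + h]` with `h ≤ x`, on which power weights are
comparable to constants. The free length `h` balances the two terms. -/
theorem IsPrimitive.enorm_rpow_le {p : ℝ} (hp : 1 ≤ p) (a b : ℝ) :
    ∃ C : ℝ≥0∞, C ≠ ⊤ ∧ ∀ U V : ℝ → ℝ, IsPrimitive U V → ∀ x h : ℝ, 0 < h → h ≤ x →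
      ‖U x‖ₑ ^ p ≤ C * (ENNReal.ofReal (h⁻¹ * x ^ (-a)) * wInt p a (Ioi 0) U +
        ENNReal.ofReal (h ^ (p - 1) * x ^ (-b)) * wInt p b (Ioi 0) V) := by
  have h0 : 0 < p := by linarith
  refine ⟨2 ^ (p - 1) * (ENNReal.ofReal (2 ^ |a|) + ENNReal.ofReal (2 ^ |b|)),
    ENNReal.mul_ne_top (ENNReal.rpow_ne_top_of_nonneg (by linarith) (by simp)) (by simp),
    fun U V hUV x h hh hhx => ?_⟩
  have hx : 0 < x := hh.trans_le hhx
  set A := ∫⁻ t in Ioc x (x + h), ‖V t‖ₑ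
  have hvol : (volume.restrict (Ioc x (x + h))) univ = ENNReal.ofReal h := by simp
  have hA : A ^ p ≤ ENNReal.ofReal (h ^ (p - 1)) * ∫⁻ t in Ioc x (x + h), ‖V t‖ₑ ^ p := by
    have hm : AEMeasurable (fun t => ‖V t‖ₑ) (volume.restrict (Ioc x (x + h))) :=
      (hUV.aemeasurable.enorm).mono_set fun y hy => hx.trans hy.1
    have := lintegral_rpow_le hm hp
    rwa [hvol, ENNReal.ofReal_rpow_of_pos hh] at this
  have hpt : ∀ y ∈ Ioc x (x + h), ‖U x‖ₑ ^ p ≤ 2 ^ (p - 1) * (‖U y‖ₑ ^ p + A ^ p) := by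
    intro y hy
    refine le_trans ?_ (ENNReal.rpow_add_le_mul_rpow_add_rpow _ _ hp)
    refine ENNReal.rpow_le_rpow ((hUV.enorm_le hx hy.1.le).trans ?_) h0.le
    gcongr
    exact lintegral_mono_set (Ioc_subset_Ioc_right hy.2)
  have h2 : (2 : ℝ≥0∞) ^ (p - 1) ≠ ⊤ :=
    ENNReal.rpow_ne_top_of_nonneg (by linarith) (by simp)
  have hint : ENNReal.ofReal h * ‖U x‖ₑ ^ p ≤
      2 ^ (p - 1) * ((∫⁻ y in Ioc x (x + h), ‖U y‖ₑ ^ p) + ENNReal.ofReal h * A ^ p) := by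
    calc ENNReal.ofReal h * ‖U x‖ₑ ^ p = ∫⁻ _ in Ioc x (x + h), ‖U x‖ₑ ^ p := by
          rw [lintegral_const, hvol, mul_comm]
      _ ≤ ∫⁻ y in Ioc x (x + h), 2 ^ (p - 1) * (‖U y‖ₑ ^ p + A ^ p) :=
          setLIntegral_mono' measurableSet_Ioc hpt
      _ = _ := by
          rw [lintegral_const_mul' _ _ h2, lintegral_add_right _ measurable_const, lintegral_const,
            hvol, mul_comm (A ^ p)]
  have hinv : ENNReal.ofReal h⁻¹ * ENNReal.ofReal h = 1 := by
    rw [← ENNReal.ofReal_mul (by positivity), inv_mul_cancel₀ hh.ne', ENNReal.ofReal_one]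
  have hU' := lintegral_Ioc_le_wInt (f := U) (a := a) p hx hhx
  have hV' := lintegral_Ioc_le_wInt (f := V) (a := b) p hx hhx
  calc ‖U x‖ₑ ^ p = ENNReal.ofReal h⁻¹ * (ENNReal.ofReal h * ‖U x‖ₑ ^ p) := by
        rw [← mul_assoc, hinv, one_mul]
    _ ≤ ENNReal.ofReal h⁻¹ * (2 ^ (p - 1) *
          ((∫⁻ y in Ioc x (x + h), ‖U y‖ₑ ^ p) + ENNReal.ofReal h * A ^ p)) := by gcongr
    _ = 2 ^ (p - 1) * (ENNReal.ofReal h⁻¹ * (∫⁻ y in Ioc x (x + h), ‖U y‖ₑ ^ p) +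
          (ENNReal.ofReal h⁻¹ * ENNReal.ofReal h) * A ^ p) := by ring
    _ ≤ 2 ^ (p - 1) * (ENNReal.ofReal h⁻¹ *
          (ENNReal.ofReal (2 ^ |a| * x ^ (-a)) * wInt p a (Ioi 0) U) +
          ENNReal.ofReal (h ^ (p - 1)) *
            (ENNReal.ofReal (2 ^ |b| * x ^ (-b)) * wInt p b (Ioi 0) V)) := by
        rw [hinv, one_mul]
        gcongr
        exact hA.trans (by gcongr)
    _ = 2 ^ (p - 1) * (ENNReal.ofReal (2 ^ |a|) *
          (ENNReal.ofReal (h⁻¹ * x ^ (-a)) * wInt p a (Ioi 0) U) +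
          ENNReal.ofReal (2 ^ |b|) *
            (ENNReal.ofReal (h ^ (p - 1) * x ^ (-b)) * wInt p b (Ioi 0) V)) := by
        rw [ENNReal.ofReal_mul (by positivity : (0 : ℝ) ≤ 2 ^ |a|),
          ENNReal.ofReal_mul (by positivity : (0 : ℝ) ≤ 2 ^ |b|),
          ENNReal.ofReal_mul (by positivity : (0 : ℝ) ≤ h⁻¹),
          ENNReal.ofReal_mul (by positivity : (0 : ℝ) ≤ h ^ (p - 1))]
        ring
    _ ≤ _ := by
        rw [mul_assoc, mul_add (_ + _)]
        gcongr
        · exact le_self_add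
        · exact le_add_self

/-- The primitives `U` with `∫ |U|^p r^a`, `∫ |U'|^p r^(b + p)` and, for `b > -1`, also
`∫ |U|^p r^b`, all bounded by `B`. -/
def energyClass (p a b : ℝ) (B : ℝ≥0∞) : Set (ℝ → ℝ) :=
  {U | ∃ V, IsPrimitive U V ∧ wInt p a (Ioi 0) U ≤ B ∧ wInt p (b + p) (Ioi 0) V ≤ B ∧
    (-1 < b → wInt p b (Ioi 0) U ≤ B)}

theorem le_mul_ofReal_of_rpow_le {p x g : ℝ} (hp : 0 < p) (hx : 0 < x) {y M : ℝ≥0∞}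
    (h : y ^ p ≤ M * ENNReal.ofReal (x ^ (-g))) :
    y ≤ M ^ p⁻¹ * ENNReal.ofReal (x ^ (-(g / p))) := by
  have h1 := ENNReal.rpow_le_rpow h (inv_nonneg.2 hp.le)
  rwa [← ENNReal.rpow_mul, mul_inv_cancel₀ hp.ne', ENNReal.rpow_one,
    ENNReal.mul_rpow_of_nonneg _ _ (inv_nonneg.2 hp.le), ofReal_rpow_rpow hx,
    neg_mul, ← div_eq_mul_inv] at h1

section Pointwise

variable {p a b : ℝ} {B : ℝ≥0∞}

/-- The scale-invariant decay estimate, from the interval length `h = x`. -/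
theorem enorm_le_of_scaling (hp : 1 ≤ p) (hB : B ≠ ⊤) :
    ∃ M : ℝ≥0∞, M ≠ ⊤ ∧ ∀ U V : ℝ → ℝ, IsPrimitive U V → wInt p b (Ioi 0) U ≤ B →
      wInt p (b + p) (Ioi 0) V ≤ B →
        ∀ x, 0 < x → ‖U x‖ₑ ≤ M * ENNReal.ofReal (x ^ (-((b + 1) / p))) := by
  obtain ⟨C, hC, h⟩ := IsPrimitive.enorm_rpow_le hp b (b + p)
  refine ⟨(C * (B + B)) ^ p⁻¹, ?_, fun U V hUV h1 h2 x hx => ?_⟩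
  · exact ENNReal.rpow_ne_top_of_nonneg (by positivity)
      (ENNReal.mul_ne_top hC (ENNReal.add_ne_top.2 ⟨hB, hB⟩))
  refine le_mul_ofReal_of_rpow_le (by linarith) hx ((h U V hUV x x hx le_rfl).trans ?_)
  have e1 : x⁻¹ * x ^ (-b) = x ^ (-(b + 1)) := by
    rw [← Real.rpow_neg_one, ← Real.rpow_add hx]; congr 1; ring
  have e2 : x ^ (p - 1) * x ^ (-(b + p)) = x ^ (-(b + 1)) := by
    rw [← Real.rpow_add hx]; congr 1; ring
  rw [e1, e2, ← mul_add, mul_assoc, mul_comm (B + B)]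
  gcongr

/-- In the limiting case `b = -1` the interval length `h = x ^ s` gives decay at infinity. -/
theorem enorm_le_at_infty (hp : 1 ≤ p) (hB : B ≠ ⊤) {s g : ℝ} (hs : s ≤ 1) (hg : g ≤ s + a)
    (hg' : g ≤ (1 - s) * (p - 1)) :
    ∃ M : ℝ≥0∞, M ≠ ⊤ ∧ ∀ U ∈ energyClass p a (-1) B,
      ∀ x, 1 ≤ x → ‖U x‖ₑ ≤ M * ENNReal.ofReal (x ^ (-(g / p))) := by
  obtain ⟨C, hC, h⟩ := IsPrimitive.enorm_rpow_le hp a (-1 + p)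
  refine ⟨(C * (B + B)) ^ p⁻¹, ?_, ?_⟩
  · exact ENNReal.rpow_ne_top_of_nonneg (by positivity)
      (ENNReal.mul_ne_top hC (ENNReal.add_ne_top.2 ⟨hB, hB⟩))
  rintro U ⟨V, hUV, h1, h2, -⟩ x hx
  have hx0 : 0 < x := by linarith
  have hsx : x ^ s ≤ x := by simpa using Real.rpow_le_rpow_of_exponent_le hx hs
  refine le_mul_ofReal_of_rpow_le (by linarith) hx0
    ((h U V hUV x (x ^ s) (Real.rpow_pos_of_pos hx0 s) hsx).trans ?_)
  have e1 : (x ^ s)⁻¹ * x ^ (-a) ≤ x ^ (-g) := by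
    rw [← Real.rpow_neg hx0.le, ← Real.rpow_add hx0]
    exact Real.rpow_le_rpow_of_exponent_le hx (by linarith)
  have e2 : (x ^ s) ^ (p - 1) * x ^ (-(-1 + p)) ≤ x ^ (-g) := by
    rw [← Real.rpow_mul hx0.le, ← Real.rpow_add hx0]
    exact Real.rpow_le_rpow_of_exponent_le hx (by linarith)
  calc _ ≤ C * (ENNReal.ofReal (x ^ (-g)) * B + ENNReal.ofReal (x ^ (-g)) * B) := by gcongr
    _ = _ := by ring

/-- In the limiting case `b = -1` the growth at the origin is slower than any power. -/
theorem enorm_le_at_zero (hp : 1 ≤ p) (ha : -1 ≤ a) (hB : B ≠ ⊤) {τ : ℝ} (hτ : 0 < τ) :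
    ∃ M : ℝ≥0∞, M ≠ ⊤ ∧ ∀ U ∈ energyClass p a (-1) B,
      ∀ x, 0 < x → x ≤ 1 → ‖U x‖ₑ ≤ M * ENNReal.ofReal (x ^ (-τ)) := by
  have h0 : 0 < p := by linarith
  obtain ⟨M₁, hM₁, h₁⟩ := enorm_le_at_infty (a := a) (s := 1) (g := 0) hp hB le_rfl
    (by linarith) (by linarith)
  set D : ℝ≥0∞ := ENNReal.ofReal (1 / τ) ^ (p - 1) * B with hD
  refine ⟨M₁ + D ^ p⁻¹, ?_, ?_⟩
  · refine ENNReal.add_ne_top.2 ⟨hM₁, ENNReal.rpow_ne_top_of_nonneg (by positivity)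
      (ENNReal.mul_ne_top (ENNReal.rpow_ne_top_of_nonneg (by linarith) ENNReal.ofReal_ne_top) hB)⟩
  intro U hU x hx hx1
  have hU1 := h₁ U hU 1 le_rfl
  obtain ⟨V, hUV, -, h2, -⟩ := hU
  have hx1' : 1 ≤ ENNReal.ofReal (x ^ (-τ)) := by
    have := Real.one_le_rpow_of_pos_of_le_one_of_nonpos hx hx1 (by linarith : -τ ≤ 0)
    simpa using ENNReal.ofReal_le_ofReal this
  let F : ℝ → ℝ≥0∞ := (Ioc 0 1).indicator fun t => ‖V t‖ₑ
  have hF : AEMeasurable F (volume.restrict (Ioi x)) :=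
    ((hUV.aemeasurable.enorm).indicator measurableSet_Ioc).mono_set (Ioi_subset_Ioi hx.le)
  have hK := lintegral_Ioi_rpow_le (σ := 1 + τ) hx (by linarith) hp hF
  have e1 : ∫⁻ t in Ioc x 1, ‖V t‖ₑ ≤ ∫⁻ t in Ioi x, F t := by
    refine le_trans (le_of_eq ?_) (lintegral_mono_set (Ioc_subset_Ioi_self : Ioc x 1 ⊆ Ioi x))
    refine setLIntegral_congr_fun measurableSet_Ioc fun t ht => ?_
    have ht' : t ∈ Ioc (0 : ℝ) 1 := ⟨hx.trans ht.1, ht.2⟩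
    simp only [F, indicator_of_mem ht']
  have e2 : ∫⁻ s in Ioi x, F s ^ p * ENNReal.ofReal (s ^ ((1 + τ) * (p - 1))) ≤ B := by
    refine le_trans ?_ h2
    refine (lintegral_mono_set (Ioi_subset_Ioi hx.le)).trans ?_
    refine setLIntegral_mono' measurableSet_Ioi fun s hs => ?_
    by_cases hs1 : s ≤ 1
    · rw [show F s = ‖V s‖ₑ from indicator_of_mem (show s ∈ Ioc (0 : ℝ) 1 from ⟨hs, hs1⟩) _]
      refine mul_le_mul_right (ENNReal.ofReal_le_ofReal ?_) _
      refine Real.rpow_le_rpow_of_exponent_ge hs hs1 ?_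
      nlinarith
    · rw [show F s = 0 from indicator_of_notMem (fun h => hs1 h.2) _, ENNReal.zero_rpow_of_pos h0]
      simp
  have e3 : ∫⁻ t in Ioi x, F t ≤ D ^ p⁻¹ * ENNReal.ofReal (x ^ (-τ)) := by
    have h3 : (∫⁻ t in Ioi x, F t) ^ p ≤ D * ENNReal.ofReal (x ^ (-(τ * (p - 1)))) := by
      refine hK.trans ?_
      have e : ENNReal.ofReal (x ^ (1 - (1 + τ)) / (1 + τ - 1)) ^ (p - 1) =
          ENNReal.ofReal (1 / τ) ^ (p - 1) * ENNReal.ofReal (x ^ (-(τ * (p - 1)))) := by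
        rw [div_eq_mul_one_div, mul_comm, add_sub_cancel_left, sub_add_cancel_left,
          ENNReal.ofReal_mul (by positivity), ENNReal.mul_rpow_of_nonneg _ _ (by linarith),
          ofReal_rpow_rpow hx, neg_mul]
      rw [e, hD, mul_right_comm]
      gcongr
    refine (le_mul_ofReal_of_rpow_le h0 hx h3).trans ?_
    refine mul_le_mul_right (ENNReal.ofReal_le_ofReal ?_) _
    refine Real.rpow_le_rpow_of_exponent_ge hx hx1 (neg_le_neg ?_)
    rw [div_le_iff₀ h0]
    nlinarith
  calc ‖U x‖ₑ ≤ ‖U 1‖ₑ + ∫⁻ t in Ioc x 1, ‖V t‖ₑ := hUV.enorm_le hx hx1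
    _ ≤ M₁ * 1 + D ^ p⁻¹ * ENNReal.ofReal (x ^ (-τ)) := by
        gcongr
        · simpa using hU1
        · exact e1.trans e3
    _ ≤ M₁ * ENNReal.ofReal (x ^ (-τ)) + D ^ p⁻¹ * ENNReal.ofReal (x ^ (-τ)) := by gcongr
    _ = _ := (add_mul _ _ _).symm

end Pointwise

/-! ### Uniform smallness near the ends of the half-line -/

theorem exists_mul_ofReal_rpow_le {K η : ℝ≥0∞} (hK : K ≠ ⊤) (hη : η ≠ 0) {d : ℝ} (hd : 0 < d) :
    ∃ ε : ℝ, 0 < ε ∧ ε ≤ 1 ∧ K * ENNReal.ofReal (ε ^ d) ≤ η := by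
  have h1 : Filter.Tendsto (fun ε : ℝ => K * ENNReal.ofReal (ε ^ d))
      (nhdsWithin 0 (Ioi 0)) (nhds 0) := by
    have h2 : ContinuousAt (fun ε : ℝ => ε ^ d) 0 :=
      Real.continuousAt_rpow_const 0 d (Or.inr hd.le)
    have h3 := (ENNReal.continuous_ofReal.continuousAt.comp h2).tendsto
    simp only [Function.comp_def, Real.zero_rpow hd.ne', ENNReal.ofReal_zero] at h3
    simpa using (ENNReal.Tendsto.const_mul h3 (Or.inr hK)).mono_left nhdsWithin_le_nhds
  have h4 : ∀ᶠ ε : ℝ in nhdsWithin 0 (Ioi 0), ε ∈ Ioc (0 : ℝ) 1 := Ioc_mem_nhdsGT one_pos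
  have h5 := h1.eventually (ge_mem_nhds (pos_iff_ne_zero.2 hη))
  obtain ⟨ε, h6, h7⟩ := (h4.and h5).exists
  exact ⟨ε, h6.1, h6.2, h7⟩

/-- The weighted `L^q`-mass near the origin is uniformly small over the class `𝓕`. -/
def SmallAtZero (q θ : ℝ) (𝓕 : Set (ℝ → ℝ)) : Prop :=
  ∀ η : ℝ≥0∞, η ≠ 0 → ∃ ε : ℝ, 0 < ε ∧ ε ≤ 1 ∧ ∀ U ∈ 𝓕, wInt q θ (Ioc 0 ε) U ≤ η

/-- The weighted `L^q`-mass near infinity is uniformly small over the class `𝓕`. -/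
def SmallAtInfty (q θ : ℝ) (𝓕 : Set (ℝ → ℝ)) : Prop :=
  ∀ η : ℝ≥0∞, η ≠ 0 → ∃ R : ℝ, 1 ≤ R ∧ ∀ U ∈ 𝓕, wInt q θ (Ioi R) U ≤ η

/-- `|U|^q` is split as `|U|^p |U|^(q - p)`, and the second factor is estimated pointwise. -/
theorem wInt_le_of_enorm_le {p q θ g e c : ℝ} {M : ℝ≥0∞} {S : Set ℝ} {U : ℝ → ℝ} (hp : 0 ≤ p)
    (hpq : p ≤ q) (hM : M ≠ ⊤) (hS : MeasurableSet S) (hS0 : S ⊆ Ioi 0)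
    (hU : ∀ x ∈ S, ‖U x‖ₑ ≤ M * ENNReal.ofReal (x ^ (-g)))
    (hc0 : 0 ≤ c) (hc : ∀ x ∈ S, x ^ (θ - g * (q - p)) ≤ c * x ^ e) :
    wInt q θ S U ≤ M ^ (q - p) * ENNReal.ofReal c * wInt p e S U := by
  have hqp : 0 ≤ q - p := by linarith
  rw [wInt, wInt, ← lintegral_const_mul' _ _ (ENNReal.mul_ne_top
    (ENNReal.rpow_ne_top_of_nonneg hqp hM) ENNReal.ofReal_ne_top)]
  refine setLIntegral_mono' hS fun x hx => ?_
  have hx0 : 0 < x := hS0 hx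
  have e1 : ‖U x‖ₑ ^ q = ‖U x‖ₑ ^ p * ‖U x‖ₑ ^ (q - p) := by
    rw [← ENNReal.rpow_add_of_nonneg _ _ hp hqp]
    congr 1; ring
  calc ‖U x‖ₑ ^ q * ENNReal.ofReal (x ^ θ)
      ≤ ‖U x‖ₑ ^ p * (M * ENNReal.ofReal (x ^ (-g))) ^ (q - p) * ENNReal.ofReal (x ^ θ) := by
        rw [e1]
        gcongr
        exact hU x hx
    _ = M ^ (q - p) * (‖U x‖ₑ ^ p * ENNReal.ofReal (x ^ (θ - g * (q - p)))) := by
        rw [ENNReal.mul_rpow_of_nonneg _ _ hqp, ofReal_rpow_rpow hx0,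
          show θ - g * (q - p) = -g * (q - p) + θ by ring, ← ofReal_rpow_mul_ofReal_rpow hx0]
        ring
    _ ≤ M ^ (q - p) * (‖U x‖ₑ ^ p * ENNReal.ofReal (c * x ^ e)) := by
        gcongr
        exact hc x hx
    _ = _ := by
        rw [ENNReal.ofReal_mul hc0]
        ring

theorem wInt_mono_set {p a : ℝ} {S T : Set ℝ} {f : ℝ → ℝ} (h : S ⊆ T) :
    wInt p a S f ≤ wInt p a T f :=
  lintegral_mono_set h

theorem wInt_Ioc_le {p q θ g e ε : ℝ} {M : ℝ≥0∞} {U : ℝ → ℝ} (hp : 0 ≤ p)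
    (hpq : p ≤ q) (hM : M ≠ ⊤) (hε : 0 < ε) (hε1 : ε ≤ 1) (he : e ≤ θ - g * (q - p))
    (hU : ∀ x, 0 < x → x ≤ 1 → ‖U x‖ₑ ≤ M * ENNReal.ofReal (x ^ (-g))) :
    wInt q θ (Ioc 0 ε) U ≤
      M ^ (q - p) * wInt p e (Ioi 0) U * ENNReal.ofReal (ε ^ (θ - g * (q - p) - e)) := by
  have h := wInt_le_of_enorm_le (θ := θ) (e := e) (c := ε ^ (θ - g * (q - p) - e)) hp hpq hM
    (measurableSet_Ioc (a := (0 : ℝ)) (b := ε)) (fun x hx => hx.1)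
    (fun x hx => hU x hx.1 (hx.2.trans hε1)) (by positivity) (fun x hx => by
      have e1 : x ^ (θ - g * (q - p)) = x ^ (θ - g * (q - p) - e) * x ^ e := by
        rw [← Real.rpow_add hx.1]; congr 1; ring
      rw [e1]
      exact mul_le_mul_of_nonneg_right (Real.rpow_le_rpow hx.1.le hx.2 (by linarith))
        (Real.rpow_nonneg hx.1.le _))
  refine h.trans ?_
  rw [mul_right_comm]
  gcongr
  exact wInt_mono_set Ioc_subset_Ioi_self

theorem wInt_Ioi_le {p q θ g e R : ℝ} {M : ℝ≥0∞} {U : ℝ → ℝ} (hp : 0 ≤ p)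
    (hpq : p ≤ q) (hM : M ≠ ⊤) (hR : 1 ≤ R) (he : θ - g * (q - p) ≤ e)
    (hU : ∀ x, 1 ≤ x → ‖U x‖ₑ ≤ M * ENNReal.ofReal (x ^ (-g))) :
    wInt q θ (Ioi R) U ≤
      M ^ (q - p) * wInt p e (Ioi 0) U * ENNReal.ofReal (R⁻¹ ^ (e - (θ - g * (q - p)))) := by
  have hR0 : 0 < R := by linarith
  have h := wInt_le_of_enorm_le (θ := θ) (e := e) (c := R⁻¹ ^ (e - (θ - g * (q - p)))) hp hpq hM
    (measurableSet_Ioi (a := R)) (Ioi_subset_Ioi hR0.le)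
    (fun x hx => hU x (hR.trans (le_of_lt hx))) (by positivity) (fun x hx => by
      have hx0 : 0 < x := hR0.trans hx
      have e1 : x ^ (θ - g * (q - p)) = x⁻¹ ^ (e - (θ - g * (q - p))) * x ^ e := by
        rw [Real.inv_rpow hx0.le, ← Real.rpow_neg hx0.le, ← Real.rpow_add hx0]; congr 1; ring
      rw [e1]
      refine mul_le_mul_of_nonneg_right (Real.rpow_le_rpow (by positivity) ?_ (by linarith))
        (Real.rpow_nonneg hx0.le _)
      exact inv_anti₀ hR0 (le_of_lt hx))
  refine h.trans ?_
  rw [mul_right_comm]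
  gcongr
  exact wInt_mono_set (Ioi_subset_Ioi hR0.le)

theorem wInt_Ioi_zero_le {q θ : ℝ} {U : ℝ → ℝ} {A B : ℝ≥0∞} (h1 : wInt q θ (Ioc 0 1) U ≤ A)
    (h2 : wInt q θ (Ioi 1) U ≤ B) : wInt q θ (Ioi 0) U ≤ A + B := by
  rw [wInt, ← Ioc_union_Ioi_eq_Ioi (zero_le_one' ℝ)]
  exact (lintegral_union_le _ _ _).trans (add_le_add h1 h2)

section EnergyClass

variable {p q a b θ : ℝ} {B : ℝ≥0∞}

theorem enorm_le_energyClass (hp : 1 ≤ p) (hb : -1 < b) (hB : B ≠ ⊤) :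
    ∃ M : ℝ≥0∞, M ≠ ⊤ ∧ ∀ U ∈ energyClass p a b B,
      ∀ x, 0 < x → ‖U x‖ₑ ≤ M * ENNReal.ofReal (x ^ (-((b + 1) / p))) := by
  obtain ⟨M, hM, h⟩ := enorm_le_of_scaling (b := b) hp hB
  exact ⟨M, hM, fun U ⟨V, hUV, _, h2, h3⟩ => h U V hUV (h3 hb) h2⟩

/-- The condition on `q` is `q ≤ p*`; it makes the remaining weight exponent at least `b`, which is
what is needed near the origin. -/
theorem exists_wInt_le (hp : 1 ≤ p) (hb : -1 < b) (hB : B ≠ ⊤) (hθ : θ ≤ a) (hpq : p ≤ q)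
    (hq : q * (b + 1) ≤ (θ + 1) * p) :
    ∃ C : ℝ≥0∞, C ≠ ⊤ ∧ ∀ U ∈ energyClass p a b B, wInt q θ (Ioi 0) U ≤ C := by
  have h0 : 0 < p := by linarith
  obtain ⟨M, hM, h⟩ := enorm_le_energyClass (a := a) hp hb hB
  have hg : (b + 1) / p * p = b + 1 := by field_simp
  have hg0 : 0 ≤ (b + 1) / p := div_nonneg (by linarith) h0.le
  have hgq : (b + 1) / p * q ≤ θ + 1 := by
    rw [div_mul_eq_mul_div, div_le_iff₀ h0]; linarith
  have hfin : M ^ (q - p) * B ≠ ⊤ :=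
    ENNReal.mul_ne_top (ENNReal.rpow_ne_top_of_nonneg (by linarith) hM) hB
  refine ⟨M ^ (q - p) * B + M ^ (q - p) * B, ENNReal.add_ne_top.2 ⟨hfin, hfin⟩, fun U hU => ?_⟩
  have hx := h U hU
  obtain ⟨V, hUV, h1, h2, h3⟩ := hU
  refine wInt_Ioi_zero_le ?_ ?_
  · refine (wInt_Ioc_le (e := b) h0.le hpq hM one_pos le_rfl (by linarith)
      (fun x hx0 _ => hx x hx0)).trans ?_
    rw [Real.one_rpow, ENNReal.ofReal_one, mul_one]
    gcongr
    exact h3 hb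
  · refine (wInt_Ioi_le (e := a) h0.le hpq hM le_rfl (by nlinarith)
      (fun x hx0 => hx x (by linarith))).trans ?_
    rw [inv_one, Real.one_rpow, ENNReal.ofReal_one, mul_one]
    gcongr

theorem smallAtZero_energyClass (hp : 1 ≤ p) (hb : -1 < b) (hB : B ≠ ⊤) (hpq : p ≤ q)
    (hq : q * (b + 1) < (θ + 1) * p) : SmallAtZero q θ (energyClass p a b B) := by
  have h0 : 0 < p := by linarith
  obtain ⟨M, hM, h⟩ := enorm_le_energyClass (a := a) hp hb hB
  have hg : (b + 1) / p * p = b + 1 := by field_simp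
  have hgq : (b + 1) / p * q < θ + 1 := by
    rw [div_mul_eq_mul_div, div_lt_iff₀ h0]; linarith
  have hfin : M ^ (q - p) * B ≠ ⊤ :=
    ENNReal.mul_ne_top (ENNReal.rpow_ne_top_of_nonneg (by linarith) hM) hB
  intro η hη
  obtain ⟨ε, hε, hε1, hle⟩ := exists_mul_ofReal_rpow_le hfin hη
    (d := θ - (b + 1) / p * (q - p) - b) (by linarith)
  refine ⟨ε, hε, hε1, fun U hU => ?_⟩
  have hx := h U hU
  obtain ⟨V, hUV, h1, h2, h3⟩ := hU
  refine (wInt_Ioc_le (e := b) h0.le hpq hM hε hε1 (by linarith)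
    (fun x hx0 _ => hx x hx0)).trans (le_trans ?_ hle)
  gcongr
  exact h3 hb

/-- A pointwise bound by `r ^ (-g)` on `[1, ∞)` makes the mass at infinity small as soon as the
remaining weight `θ - g (q - p)` is below `a`. -/
theorem smallAtInfty_of_enorm_le {g : ℝ} (hp : 0 ≤ p) (hB : B ≠ ⊤) (hpq : p ≤ q)
    (hg : θ - g * (q - p) < a)
    (h : ∃ M : ℝ≥0∞, M ≠ ⊤ ∧ ∀ U ∈ energyClass p a b B,
      ∀ x, 1 ≤ x → ‖U x‖ₑ ≤ M * ENNReal.ofReal (x ^ (-g))) :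
    SmallAtInfty q θ (energyClass p a b B) := by
  obtain ⟨M, hM, h⟩ := h
  have hfin : M ^ (q - p) * B ≠ ⊤ :=
    ENNReal.mul_ne_top (ENNReal.rpow_ne_top_of_nonneg (by linarith) hM) hB
  intro η hη
  obtain ⟨ε, hε, hε1, hle⟩ := exists_mul_ofReal_rpow_le hfin hη
    (d := a - (θ - g * (q - p))) (by linarith)
  refine ⟨ε⁻¹, (one_le_inv₀ hε).2 hε1, fun U hU => ?_⟩
  have hx := h U hU
  obtain ⟨V, hUV, h1, h2, h3⟩ := hU
  refine (wInt_Ioi_le (e := a) hp hpq hM ((one_le_inv₀ hε).2 hε1) hg.le hx).trans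
    (le_trans ?_ hle)
  rw [inv_inv]
  gcongr

theorem smallAtInfty_energyClass (hp : 1 ≤ p) (hb : -1 < b) (hB : B ≠ ⊤) (hpq : p ≤ q)
    (hθ : θ < a ∨ θ ≤ a ∧ p < q) : SmallAtInfty q θ (energyClass p a b B) := by
  have h0 : 0 < p := by linarith
  have hg0 : 0 < (b + 1) / p := div_pos (by linarith) h0
  obtain ⟨M, hM, h⟩ := enorm_le_energyClass (a := a) hp hb hB
  refine smallAtInfty_of_enorm_le h0.le hB hpq ?_
    ⟨M, hM, fun U hU x hx => h U hU x (by linarith)⟩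
  rcases hθ with hθ | ⟨hθ, hq⟩
  · have := mul_nonneg hg0.le (sub_nonneg.2 hpq)
    linarith
  · have := mul_pos hg0 (sub_pos.2 hq)
    linarith

/-- In the limiting case the slow growth at the origin is absorbed by the weight, without any use of
the integrability of `|U|^p`. -/
theorem wInt_Ioc_le_limiting (hp : 1 ≤ p) (ha : -1 ≤ a) (hB : B ≠ ⊤) (hq : 0 < q) (hθ : -1 < θ) :
    ∃ K : ℝ≥0∞, K ≠ ⊤ ∧ ∃ d : ℝ, 0 < d ∧ ∀ U ∈ energyClass p a (-1) B, ∀ ε : ℝ, 0 < ε → ε ≤ 1 →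
      wInt q θ (Ioc 0 ε) U ≤ K * ENNReal.ofReal (ε ^ d) := by
  -- `τ` is chosen so that `r ^ (θ - τ q)` is still integrable at the origin.
  set τ := (θ + 1) / (2 * q) with hτ
  have hτ0 : 0 < τ := by rw [hτ]; apply div_pos <;> linarith
  have hτq : τ * q = (θ + 1) / 2 := by rw [hτ]; field_simp
  obtain ⟨M, hM, h⟩ := enorm_le_at_zero hp ha hB hτ0
  have hd : 0 < θ - τ * q + 1 := by linarith
  refine ⟨M ^ q * ENNReal.ofReal (1 / (θ - τ * q + 1)), ENNReal.mul_ne_top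
    (ENNReal.rpow_ne_top_of_nonneg hq.le hM) ENNReal.ofReal_ne_top, θ - τ * q + 1, hd,
    fun U hU ε hε hε1 => ?_⟩
  calc wInt q θ (Ioc 0 ε) U
      ≤ ∫⁻ x in Ioc 0 ε, M ^ q * ENNReal.ofReal (x ^ (θ - τ * q)) := by
        refine setLIntegral_mono' measurableSet_Ioc fun x hx => ?_
        calc _ ≤ (M * ENNReal.ofReal (x ^ (-τ))) ^ q * ENNReal.ofReal (x ^ θ) := by
              gcongr
              exact h U hU x hx.1 (hx.2.trans hε1)
          _ = _ := by
              rw [ENNReal.mul_rpow_of_nonneg _ _ hq.le, ofReal_rpow_rpow hx.1, mul_assoc,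
                ofReal_rpow_mul_ofReal_rpow hx.1]
              congr 3; ring
    _ = _ := by
        rw [lintegral_const_mul' _ _ (ENNReal.rpow_ne_top_of_nonneg hq.le hM),
          lintegral_Ioc_rpow (by linarith) hε.le, div_eq_mul_one_div, mul_comm (ε ^ _),
          ENNReal.ofReal_mul (by positivity), mul_assoc]

theorem smallAtZero_limiting (hp : 1 ≤ p) (ha : -1 ≤ a) (hB : B ≠ ⊤) (hq : 0 < q) (hθ : -1 < θ) :
    SmallAtZero q θ (energyClass p a (-1) B) := by
  obtain ⟨K, hK, d, hd, h⟩ := wInt_Ioc_le_limiting hp ha hB hq hθ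
  intro η hη
  obtain ⟨ε, hε, hε1, hle⟩ := exists_mul_ofReal_rpow_le hK hη hd
  exact ⟨ε, hε, hε1, fun U hU => (h U hU ε hε hε1).trans hle⟩

theorem smallAtInfty_limiting (hp : 1 ≤ p) (ha : -1 ≤ a) (hB : B ≠ ⊤) (hpq : p ≤ q)
    (hθ : θ < a ∨ θ ≤ a ∧ p < q ∧ 1 < p ∧ -1 < a) :
    SmallAtInfty q θ (energyClass p a (-1) B) := by
  have h0 : 0 < p := by linarith
  rcases hθ with hθ | ⟨hθ, hq, hp1, ha1⟩
  · refine smallAtInfty_of_enorm_le (g := 0 / p) h0.le hB hpq (by simpa using hθ)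
      (enorm_le_at_infty (s := 1) hp hB le_rfl (by linarith) (by linarith))
  -- The interval length `x ^ s` with `s` halfway between `-a` and `1`.
  · have hg : 0 < min ((1 - a) / 2 + a) ((1 - (1 - a) / 2) * (p - 1)) :=
      lt_min (by linarith) (mul_pos (by linarith) (by linarith))
    refine smallAtInfty_of_enorm_le h0.le hB hpq ?_
      (enorm_le_at_infty (s := (1 - a) / 2) hp hB (by linarith) (min_le_left _ _)
        (min_le_right _ _))
    have := mul_pos (div_pos hg h0) (sub_pos.2 hq)
    linarith

theorem exists_wInt_le_limiting (hp : 1 ≤ p) (ha : -1 ≤ a) (hB : B ≠ ⊤) (hpq : p ≤ q)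
    (hθ : θ ≤ a) (hθ' : -1 < θ ∨ θ = a ∧ a = -1) :
    ∃ C : ℝ≥0∞, C ≠ ⊤ ∧ ∀ U ∈ energyClass p a (-1) B, wInt q θ (Ioi 0) U ≤ C := by
  have h0 : 0 < p := by linarith
  obtain ⟨M, hM, h⟩ := enorm_le_at_infty (a := a) (s := 1) (g := 0) hp hB le_rfl
    (by linarith) (by linarith)
  rw [zero_div] at h
  have hfin : ∀ M : ℝ≥0∞, M ≠ ⊤ → M ^ (q - p) * B ≠ ⊤ := fun M hM =>
    ENNReal.mul_ne_top (ENNReal.rpow_ne_top_of_nonneg (by linarith) hM) hB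
  have hinf : ∀ U ∈ energyClass p a (-1) B, wInt q θ (Ioi 1) U ≤ M ^ (q - p) * B := by
    intro U hU
    have hx := h U hU
    obtain ⟨V, hUV, h1, h2, h3⟩ := hU
    refine (wInt_Ioi_le (e := a) h0.le hpq hM le_rfl (by linarith) hx).trans ?_
    rw [inv_one, Real.one_rpow, ENNReal.ofReal_one, mul_one]
    gcongr
  rcases hθ' with hθ' | ⟨rfl, rfl⟩
  · obtain ⟨K, hK, d, hd, hz⟩ := wInt_Ioc_le_limiting hp ha hB (by linarith : 0 < q) hθ'
    refine ⟨K + M ^ (q - p) * B, ENNReal.add_ne_top.2 ⟨hK, hfin M hM⟩, fun U hU => ?_⟩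
    refine wInt_Ioi_zero_le ?_ (hinf U hU)
    simpa using hz U hU 1 one_pos le_rfl
  -- For `a = -1` the scaling estimate bounds `U` on all of `(0, ∞)`.
  · obtain ⟨M', hM', h'⟩ := enorm_le_of_scaling (b := -1) hp hB
    refine ⟨M' ^ (q - p) * B + M ^ (q - p) * B, ENNReal.add_ne_top.2 ⟨hfin M' hM', hfin M hM⟩,
      fun U hU => wInt_Ioi_zero_le ?_ (hinf U hU)⟩
    obtain ⟨V, hUV, h1, h2, h3⟩ := hU
    have hx := h' U V hUV h1 h2
    rw [neg_add_cancel, zero_div] at hx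
    refine (wInt_Ioc_le (e := -1) h0.le hpq hM' one_pos le_rfl (by linarith)
      (fun x hx0 _ => hx x hx0)).trans ?_
    rw [Real.one_rpow, ENNReal.ofReal_one, mul_one]
    gcongr

end EnergyClass

/-! ### Compactness on bounded intervals away from the origin -/

theorem exists_rpow_le_on_Icc {ε R : ℝ} (hε : 0 < ε) (c : ℝ) :
    ∃ K : ℝ, 0 ≤ K ∧ ∀ x ∈ Icc ε R, x ^ c ≤ K := by
  have hc : ContinuousOn (fun x : ℝ => x ^ c) (Icc ε R) := fun x hx =>
    (Real.continuousAt_rpow_const x c (Or.inl (hε.trans_le hx.1).ne')).continuousWithinAt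
  obtain ⟨K, hK⟩ := isCompact_Icc.exists_bound_of_continuousOn hc
  exact ⟨max K 0, le_max_right _ _, fun x hx =>
    (le_abs_self _).trans ((hK x hx).trans (le_max_left _ _))⟩

section Local

variable {p q a b θ : ℝ} {B : ℝ≥0∞} {ε R : ℝ}

theorem exists_enorm_le_on_Icc (hp : 1 ≤ p) (hB : B ≠ ⊤) (hε : 0 < ε) :
    ∃ M : ℝ≥0∞, M ≠ ⊤ ∧ ∀ U ∈ energyClass p a b B, ∀ x ∈ Icc ε R, ‖U x‖ₑ ≤ M := by
  have h0 : 0 < p := by linarith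
  obtain ⟨C, hC, h⟩ := IsPrimitive.enorm_rpow_le hp a (b + p)
  obtain ⟨K₁, -, hK₁⟩ := exists_rpow_le_on_Icc (R := R) hε (-1 - a)
  obtain ⟨K₂, -, hK₂⟩ := exists_rpow_le_on_Icc (R := R) hε (p - 1 - (b + p))
  refine ⟨(C * (ENNReal.ofReal K₁ * B + ENNReal.ofReal K₂ * B)) ^ p⁻¹, ?_, ?_⟩
  · exact ENNReal.rpow_ne_top_of_nonneg (by positivity) (ENNReal.mul_ne_top hC
      (ENNReal.add_ne_top.2 ⟨ENNReal.mul_ne_top ENNReal.ofReal_ne_top hB,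
        ENNReal.mul_ne_top ENNReal.ofReal_ne_top hB⟩))
  rintro U ⟨V, hUV, h1, h2, -⟩ x hx
  have hx0 : 0 < x := hε.trans_le hx.1
  have e1 : x⁻¹ * x ^ (-a) ≤ K₁ := by
    rw [← Real.rpow_neg_one, ← Real.rpow_add hx0]
    exact hK₁ x hx
  have e2 : x ^ (p - 1) * x ^ (-(b + p)) ≤ K₂ := by
    rw [← Real.rpow_add hx0]
    exact hK₂ x hx
  rw [ENNReal.le_rpow_inv_iff h0]
  refine (h U V hUV x x hx0 le_rfl).trans ?_
  gcongr

theorem exists_lintegral_deriv_le (hp : 1 ≤ p) (hB : B ≠ ⊤) (hε : 0 < ε) :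
    ∃ M : ℝ≥0∞, M ≠ ⊤ ∧ ∀ U V : ℝ → ℝ, IsPrimitive U V → wInt p b (Ioi 0) V ≤ B →
      ∫⁻ x in Ioc ε R, ‖V x‖ₑ ≤ M := by
  have h0 : 0 < p := by linarith
  obtain ⟨K, hK0, hK⟩ := exists_rpow_le_on_Icc (R := R) hε (-b)
  refine ⟨(ENNReal.ofReal (R - ε) ^ (p - 1) * (ENNReal.ofReal K * B)) ^ p⁻¹, ?_, ?_⟩
  · exact ENNReal.rpow_ne_top_of_nonneg (by positivity) (ENNReal.mul_ne_top
      (ENNReal.rpow_ne_top_of_nonneg (by linarith) ENNReal.ofReal_ne_top)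
      (ENNReal.mul_ne_top ENNReal.ofReal_ne_top hB))
  intro U V hUV h
  have hm : AEMeasurable (fun t => ‖V t‖ₑ) (volume.restrict (Ioc ε R)) :=
    (hUV.aemeasurable.enorm).mono_set fun y hy => hε.trans hy.1
  have hJ := lintegral_rpow_le hm hp
  rw [Measure.restrict_apply_univ, Real.volume_Ioc] at hJ
  rw [ENNReal.le_rpow_inv_iff h0]
  refine hJ.trans ?_
  gcongr
  calc ∫⁻ x in Ioc ε R, ‖V x‖ₑ ^ p
      ≤ ∫⁻ x in Ioc ε R, ENNReal.ofReal K * (‖V x‖ₑ ^ p * ENNReal.ofReal (x ^ b)) := by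
        refine setLIntegral_mono' measurableSet_Ioc fun x hx => ?_
        have hx0 : 0 < x := hε.trans hx.1
        have h1 : 1 ≤ ENNReal.ofReal K * ENNReal.ofReal (x ^ b) := by
          rw [← ENNReal.ofReal_mul hK0, ← ENNReal.ofReal_one]
          refine ENNReal.ofReal_le_ofReal ?_
          have h2 := hK x ⟨hx.1.le, hx.2⟩
          rwa [Real.rpow_neg hx0.le, inv_le_iff_one_le_mul₀ (Real.rpow_pos_of_pos hx0 b)] at h2
        calc ‖V x‖ₑ ^ p = 1 * ‖V x‖ₑ ^ p := (one_mul _).symm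
          _ ≤ _ := mul_le_mul_left h1 _
          _ = _ := by ring
    _ = ENNReal.ofReal K * wInt p b (Ioc ε R) V :=
        lintegral_const_mul' _ _ ENNReal.ofReal_ne_top
    _ ≤ _ := by
        gcongr
        exact (wInt_mono_set fun y hy => hε.trans hy.1).trans h

/-- On an interval, a primitive deviates from its mean by at most the integral of its
derivative. -/
theorem IsPrimitive.lintegral_Ioc_le {U V : ℝ → ℝ} (h : IsPrimitive U V) {c l : ℝ} (hc : 0 < c)
    (hl : 0 < l) : ∫⁻ x in Ioc c (c + l), ‖U x‖ₑ ≤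
      ‖∫ x in Ioc c (c + l), U x‖ₑ + ENNReal.ofReal l * ∫⁻ x in Ioc c (c + l), ‖V x‖ₑ := by
  set I := Ioc c (c + l) with hI
  set A := ∫⁻ x in I, ‖V x‖ₑ
  have hvol : volume I = ENNReal.ofReal l := by simp [hI]
  have hosc : ∀ x ∈ I, ∀ y ∈ I, ‖U x - U y‖ₑ ≤ A := by
    intro x hx y hy
    rcases le_total x y with hxy | hxy
    · exact (h.enorm_sub_le (hc.trans hx.1) hxy).trans
        (lintegral_mono_set (Ioc_subset_Ioc hx.1.le hy.2))
    · rw [← neg_sub, enorm_neg]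
      exact (h.enorm_sub_le (hc.trans hy.1) hxy).trans
        (lintegral_mono_set (Ioc_subset_Ioc hy.1.le hx.2))
  have hint : IntegrableOn U I := by
    refine (ContinuousOn.integrableOn_compact isCompact_Icc
      (h.continuousOn.mono ?_)).mono_set Ioc_subset_Icc_self
    exact fun y hy => hc.trans_le hy.1
  have hx : ∀ x ∈ I, ENNReal.ofReal l * ‖U x‖ₑ ≤ ‖∫ y in I, U y‖ₑ + ENNReal.ofReal l * A := by
    intro x hx
    have e : l * U x = (∫ y in I, U y) + ∫ y in I, (U x - U y) := by
      have hconst : IntegrableOn (fun _ : ℝ => U x) I :=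
        integrableOn_const (by rw [hvol]; exact ENNReal.ofReal_ne_top)
      rw [integral_sub hconst hint, setIntegral_const, measureReal_def, hvol,
        ENNReal.toReal_ofReal hl.le, smul_eq_mul]
      ring
    calc ENNReal.ofReal l * ‖U x‖ₑ = ‖l * U x‖ₑ := by
          rw [enorm_mul, Real.enorm_of_nonneg hl.le]
      _ ≤ ‖∫ y in I, U y‖ₑ + ‖∫ y in I, (U x - U y)‖ₑ := by
          rw [e]; exact enorm_add_le _ _
      _ ≤ ‖∫ y in I, U y‖ₑ + ∫⁻ y in I, A := by
          gcongr
          refine (enorm_integral_le_lintegral_enorm _).trans ?_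
          exact setLIntegral_mono' measurableSet_Ioc fun y hy => hosc x hx y hy
      _ = _ := by rw [lintegral_const, Measure.restrict_apply_univ, hvol, mul_comm A]
  have hl0 : ENNReal.ofReal l ≠ 0 := by simpa using hl
  refine (ENNReal.mul_le_mul_iff_right hl0 ENNReal.ofReal_ne_top).1 ?_
  rw [← lintegral_const_mul' _ _ ENNReal.ofReal_ne_top]
  refine (setLIntegral_mono' measurableSet_Ioc hx).trans_eq ?_
  rw [lintegral_const, Measure.restrict_apply_univ, hvol, mul_comm]

theorem lintegral_Ioc_eq_sum (f : ℝ → ℝ≥0∞) {l : ℝ} (hl : 0 ≤ l) (c : ℝ) (n : ℕ) :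
    ∫⁻ x in Ioc c (c + n * l), f x =
      ∑ i ∈ Finset.range n, ∫⁻ x in Ioc (c + i * l) (c + i * l + l), f x := by
  induction n with
  | zero => simp
  | succ n ih =>
    have e : c + ((n + 1 : ℕ) : ℝ) * l = c + n * l + l := by push_cast; ring
    have h1 : c ≤ c + n * l := by have := mul_nonneg n.cast_nonneg hl (α := ℝ); linarith
    rw [Finset.sum_range_succ, ← ih, e,
      ← Ioc_union_Ioc_eq_Ioc h1 (by linarith : c + n * l ≤ c + n * l + l),
      lintegral_union measurableSet_Ioc]
    rw [Set.disjoint_left]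
    exact fun x hx hx' => absurd hx.2 (not_le.2 hx'.1)

/-- On a compact interval the weighted `L^q`-mass is small as soon as finitely many integrals over
subintervals are small. -/
theorem exists_wInt_Ioc_le_of_sum (hp : 1 ≤ p) (hq : 1 ≤ q) (hB : B ≠ ⊤) (hε : 0 < ε)
    (hεR : ε < R) {η : ℝ≥0∞} (hη : η ≠ 0) :
    ∃ (n : ℕ) (l : ℝ) (δ : ℝ), 0 < l ∧ 0 < δ ∧ ∀ U ∈ energyClass p a b B,
      ∑ i ∈ Finset.range n, ‖∫ x in Ioc (ε + i * l) (ε + i * l + l), U x‖ₑ ≤ ENNReal.ofReal δ →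
        wInt q θ (Ioc ε R) U ≤ η := by
  obtain ⟨M, hM, hUM⟩ := exists_enorm_le_on_Icc (a := a) (b := b) (R := R) hp hB hε
  obtain ⟨A, hA, hVA⟩ := exists_lintegral_deriv_le (b := b + p) (R := R) hp hB hε
  obtain ⟨K, -, hK⟩ := exists_rpow_le_on_Icc (R := R) hε θ
  set D := M ^ (q - 1) * ENNReal.ofReal K with hD
  have hDtop : D ≠ ⊤ := ENNReal.mul_ne_top
    (ENNReal.rpow_ne_top_of_nonneg (by linarith) hM) ENNReal.ofReal_ne_top
  have hη2 : η / 2 ≠ 0 := by simpa using hη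
  obtain ⟨δ, hδ, -, hδle⟩ := exists_mul_ofReal_rpow_le hDtop hη2 one_pos
  obtain ⟨t, ht, -, htle⟩ := exists_mul_ofReal_rpow_le (ENNReal.mul_ne_top hDtop hA) hη2 one_pos
  rw [Real.rpow_one] at hδle htle
  obtain ⟨n, hn⟩ := exists_nat_gt ((R - ε) / t)
  have hn0 : (0 : ℝ) < n := lt_of_le_of_lt (div_nonneg (by linarith) ht.le) hn
  have hl : 0 < (R - ε) / n := div_pos (by linarith) hn0
  have hlt : (R - ε) / n ≤ t := by
    rw [div_lt_iff₀ ht] at hn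
    rw [div_le_iff₀ hn0]; linarith
  refine ⟨n, (R - ε) / n, δ, hl, hδ, fun U hU hsum => ?_⟩
  set l := (R - ε) / n with hldef
  have hUx := hUM U hU
  obtain ⟨V, hUV, -, h2, -⟩ := hU
  have hVle := hVA U V hUV h2
  have hR : ε + n * l = R := by rw [hldef]; field_simp; ring
  have hL1 : ∫⁻ x in Ioc ε R, ‖U x‖ₑ ≤ ENNReal.ofReal δ + ENNReal.ofReal l * A := by
    rw [← hR, lintegral_Ioc_eq_sum _ hl.le] at hVle ⊢
    calc _ ≤ ∑ i ∈ Finset.range n, (‖∫ x in Ioc (ε + i * l) (ε + i * l + l), U x‖ₑ +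
          ENNReal.ofReal l * ∫⁻ x in Ioc (ε + i * l) (ε + i * l + l), ‖V x‖ₑ) := by
          refine Finset.sum_le_sum fun i _ => hUV.lintegral_Ioc_le ?_ hl
          positivity
      _ ≤ _ := by
          rw [Finset.sum_add_distrib, ← Finset.mul_sum]
          gcongr
  calc wInt q θ (Ioc ε R) U ≤ ∫⁻ x in Ioc ε R, D * ‖U x‖ₑ := by
        refine setLIntegral_mono' measurableSet_Ioc fun x hx => ?_
        have hx' : x ∈ Icc ε R := Ioc_subset_Icc_self hx
        have e1 : ‖U x‖ₑ ^ q = ‖U x‖ₑ ^ (q - 1) * ‖U x‖ₑ := by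
          conv_rhs => rw [← ENNReal.rpow_one ‖U x‖ₑ, ← ENNReal.rpow_mul, one_mul,
            ← ENNReal.rpow_add_of_nonneg _ _ (by linarith) zero_le_one, sub_add_cancel]
        rw [e1, hD, mul_right_comm]
        gcongr
        · exact hUx x hx'
        · exact hK x hx'
    _ = D * ∫⁻ x in Ioc ε R, ‖U x‖ₑ := lintegral_const_mul' _ _ hDtop
    _ ≤ D * (ENNReal.ofReal δ + ENNReal.ofReal t * A) := by
        gcongr
        exact hL1.trans (by gcongr)
    _ = D * ENNReal.ofReal δ + D * A * ENNReal.ofReal t := by ring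
    _ ≤ η / 2 + η / 2 := by gcongr
    _ = η := ENNReal.add_halves η

end Local

/-- A bounded operator is compact if it is small on those elements of the unit ball on which a
bounded finite-rank map is small. -/
theorem isCompactOperator_of_finite_rank_control {E F : Type*} [NormedAddCommGroup E]
    [NormedSpace ℝ E] [NormedAddCommGroup F] [NormedSpace ℝ F] [CompleteSpace F] (T : E →L[ℝ] F)
    (h : ∀ η : ℝ, 0 < η → ∃ (n : ℕ) (L : E →ₗ[ℝ] (Fin n → ℝ)) (K δ : ℝ), 0 < δ ∧
      (∀ u, ‖u‖ ≤ 1 → ‖L u‖ ≤ K) ∧ ∀ u, ‖u‖ ≤ 1 → ‖L u‖ ≤ δ → ‖T u‖ ≤ η) :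
    IsCompactOperator T := by
  rw [← ContinuousLinearMap.coe_coe,
    isCompactOperator_iff_isCompact_closure_image_closedBall _ one_pos]
  refine TotallyBounded.isCompact_of_isClosed (TotallyBounded.closure ?_) isClosed_closure
  rw [Metric.totallyBounded_iff]
  intro η hη
  obtain ⟨n, L, K, δ, hδ, hK, hT⟩ := h (η / 4) (by positivity)
  have hbdd : TotallyBounded (L '' Metric.closedBall 0 1) := by
    refine (isCompact_closedBall (0 : Fin n → ℝ) K).totallyBounded.subset ?_
    rintro _ ⟨u, hu, rfl⟩
    rw [mem_closedBall_zero_iff] at hu ⊢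
    exact hK u hu
  obtain ⟨t, ht, htf, hcov⟩ := Metric.finite_approx_of_totallyBounded hbdd δ hδ
  obtain ⟨s, hs, hsf, hcov⟩ := (exists_subset_image_finite_and
    (p := fun t => L '' Metric.closedBall 0 1 ⊆ ⋃ y ∈ t, Metric.ball y δ)).1 ⟨t, ht, htf, hcov⟩
  refine ⟨T '' s, hsf.image T, ?_⟩
  rintro _ ⟨u, hu, rfl⟩
  obtain ⟨y, hy, hyu⟩ := mem_iUnion₂.1 (hcov (mem_image_of_mem L hu))
  obtain ⟨v, hv, rfl⟩ := hy
  refine mem_iUnion₂.2 ⟨T v, mem_image_of_mem T hv, ?_⟩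
  have hu1 := mem_closedBall_zero_iff.1 hu
  have hv1 := mem_closedBall_zero_iff.1 (hs hv)
  -- The difference of two elements of the unit ball is twice an element of the unit ball.
  have hw : ‖(2⁻¹ : ℝ) • (u - v)‖ ≤ 1 := by
    rw [norm_smul, Real.norm_of_nonneg (by norm_num)]
    linarith [norm_sub_le u v]
  have hLw : ‖L ((2⁻¹ : ℝ) • (u - v))‖ ≤ δ := by
    rw [map_smul, norm_smul, Real.norm_of_nonneg (by norm_num), map_sub]
    rw [Metric.mem_ball, dist_eq_norm] at hyu
    linarith [norm_nonneg (L u - L v)]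
  have := hT _ hw hLw
  rw [map_smul, norm_smul, Real.norm_of_nonneg (by norm_num), map_sub] at this
  rw [Metric.mem_ball, dist_eq_norm, ContinuousLinearMap.coe_coe]
  linarith

/-! ### Estimates for the elements of the Sobolev space -/

theorem wInt_congr_ae {p a : ℝ} {S : Set ℝ} {f g : ℝ → ℝ} (hS : S ⊆ Ioi 0)
    (h : f =ᵐ[volume.restrict (Ioi 0)] g) : wInt p a S f = wInt p a S g := by
  refine lintegral_congr_ae ?_
  filter_upwards [ae_restrict_of_ae_restrict_of_subset hS h] with r hr
  rw [hr]

theorem eLpNorm_weight {q a : ℝ} (hq : 0 < q) {f : ℝ → ℝ}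
    (hf : AEStronglyMeasurable f (volume.restrict (Ioi 0))) :
    eLpNorm f (ENNReal.ofReal q) (weight a) = wInt q a (Ioi 0) f ^ (1 / q) := by
  rw [eLpNorm_eq_lintegral_rpow_enorm_toReal (by simpa using hq) ENNReal.ofReal_ne_top,
    ENNReal.toReal_ofReal hq.le, weight, lintegral_withDensity_eq_lintegral_mul₀
      (Measurable.ennreal_ofReal (by fun_prop)).aemeasurable (hf.enorm.pow_const q)]
  simp only [wInt, Pi.mul_apply, mul_comm]

theorem memLp_weight {q a : ℝ} (hq : 0 < q) {f : ℝ → ℝ}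
    (hf : AEStronglyMeasurable f (volume.restrict (Ioi 0))) (h : wInt q a (Ioi 0) f ≠ ⊤) :
    MemLp f (ENNReal.ofReal q) (weight a) := by
  refine ⟨hf.mono_ac (weight_ac a), ?_⟩
  rw [eLpNorm_weight hq hf]
  exact ENNReal.rpow_lt_top_of_nonneg (by positivity) h

theorem enorm_WLp_rpow {q a : ℝ} (hq : 0 < q) (f : WLp q a) :
    ‖f‖ₑ ^ q = wInt q a (Ioi 0) f := by
  have hf : AEStronglyMeasurable f (volume.restrict (Ioi 0)) :=
    (Lp.aestronglyMeasurable f).mono_ac (ac_weight a)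
  rw [Lp.enorm_def, eLpNorm_weight hq hf, ← ENNReal.rpow_mul, one_div_mul_cancel hq.ne',
    ENNReal.rpow_one]

section Space

variable {k : ℕ} {p : ℝ} {α : Fin (k + 1) → ℝ}

theorem integrableOn_toFun0 (u : X k p α) {c d : ℝ} (hc : 0 < c) :
    IntegrableOn (toFun0 u) (Ioc c d) :=
  ((hasWeakDeriv_weakDeriv u 0).1.integrableOn_compact_subset
    (fun _ hx => hc.trans_le hx.1 : Icc c d ⊆ Ioi 0) isCompact_Icc).mono_set Ioc_subset_Icc_self

/-- The integrals of a function of the Sobolev space over the `n` consecutive intervals of length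
`l` to the right of `c`. -/
noncomputable def intervalIntegrals (k : ℕ) (p : ℝ) (α : Fin (k + 1) → ℝ) (n : ℕ)
    {c l : ℝ} (hc : 0 < c) (hl : 0 < l) : X k p α →ₗ[ℝ] (Fin n → ℝ) where
  toFun u i := ∫ x in Ioc (c + (i : ℕ) * l) (c + (i : ℕ) * l + l), toFun0 u x
  map_add' u v := by
    ext i
    have hci : 0 < c + (i : ℕ) * l := by positivity
    rw [Pi.add_apply, ← integral_add (integrableOn_toFun0 u hci) (integrableOn_toFun0 v hci)]
    refine integral_congr_ae (ae_restrict_of_ae_restrict_of_subset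
      (fun _ hx => hci.trans hx.1) (AEEqFun.coeFn_add (toFun0 u) (toFun0 v)))
  map_smul' r u := by
    ext i
    have hci : 0 < c + (i : ℕ) * l := by positivity
    rw [RingHom.id_apply, Pi.smul_apply, smul_eq_mul, ← integral_const_mul]
    refine integral_congr_ae (ae_restrict_of_ae_restrict_of_subset
      (fun _ hx => hci.trans hx.1) (AEEqFun.coeFn_smul r (toFun0 u)))

variable [Fact (1 ≤ p)]

theorem wInt_weakDeriv_le_one {u : X k p α} (hu : ‖u‖ ≤ 1) (j : Fin (k + 1)) :
    wInt p (α j) (Ioi 0) (weakDeriv u j) ≤ 1 := by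
  have hp : 0 < p := lt_of_lt_of_le one_pos Fact.out
  have h : ‖weakDeriv u j‖ ≤ ‖u‖ := PiLp.norm_apply_le (jet u) j
  rw [← enorm_WLp_rpow hp]
  refine ENNReal.rpow_le_one ?_ hp.le
  rw [← ofReal_norm]
  exact ENNReal.ofReal_le_one.2 (h.trans hu)

/-- Iterated Hardy inequality: every derivative lies in the space with the scaling-critical weight
exponent `α_k - (k - j) p`, as long as this exponent is larger than `-1`. -/
theorem exists_wInt_weakDeriv_le {b : ℝ} (hb : α (Fin.last k) = b + k * p)
    (hα : ∀ j : Fin (k + 1), b + j * p ≤ α j) (j : ℕ) (hj : j ≤ k) (hbj : -1 < b + j * p) :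
    ∃ C : ℝ≥0∞, C ≠ ⊤ ∧ ∀ u : X k p α, ‖u‖ ≤ 1 →
      wInt p (b + j * p) (Ioi 0) (weakDeriv u ⟨j, Nat.lt_succ_of_le hj⟩) ≤ C := by
  have hp : 1 ≤ p := Fact.out
  induction hj using Nat.decreasingInduction with
  | self =>
    refine ⟨1, ENNReal.one_ne_top, fun u hu => ?_⟩
    rw [← hb]
    exact wInt_weakDeriv_le_one hu (Fin.last k)
  | of_succ j hj ih =>
    have e : b + ((j + 1 : ℕ) : ℝ) * p - p = b + j * p := by push_cast; ring
    obtain ⟨C, hC, h⟩ := ih (by linarith)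
    obtain ⟨C', hC', h'⟩ := IsPrimitive.hardy (a := b + ((j + 1 : ℕ) : ℝ) * p) hp (by linarith)
    rw [e] at h'
    refine ⟨C' * C, ENNReal.mul_ne_top hC' hC, fun u hu => ?_⟩
    have hw := HasWeakDeriv.of_succ (hasWeakDeriv_weakDeriv u ⟨j, by omega⟩)
      (hasWeakDeriv_weakDeriv u ⟨j + 1, by omega⟩)
    obtain ⟨U, hU, hUae⟩ := hw.exists_isPrimitive
    rw [← wInt_congr_ae subset_rfl hUae]
    have hfin := wInt_weakDeriv_le_one hu ⟨j, by omega⟩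
    rw [← wInt_congr_ae subset_rfl hUae] at hfin
    refine (h' U _ (α ⟨j, by omega⟩) hU ?_ (ne_top_of_le_ne_top ENNReal.one_ne_top hfin)).trans ?_
    · have := hα ⟨j, by omega⟩
      simp only at this
      linarith
    · gcongr
      exact h u hu

/-- The reduction to first order: the unit ball consists of representatives in one energy class. -/
theorem exists_mem_energyClass {b : ℝ} (hk : 1 ≤ k) (hb : α (Fin.last k) = b + k * p)
    (hα : ∀ j : Fin (k + 1), b + j * p ≤ α j) (hb1 : -1 ≤ b) :
    ∃ B : ℝ≥0∞, B ≠ ⊤ ∧ ∀ u : X k p α, ‖u‖ ≤ 1 →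
      ∃ U ∈ energyClass p (α 0) b B, U =ᵐ[volume.restrict (Ioi 0)] toFun0 u := by
  have hp : 1 ≤ p := Fact.out
  obtain ⟨C₁, hC₁, h₁⟩ := exists_wInt_weakDeriv_le hb hα 1 hk (by push_cast; linarith)
  have h₀ : ∃ C₀ : ℝ≥0∞, C₀ ≠ ⊤ ∧ ∀ u : X k p α, ‖u‖ ≤ 1 → -1 < b →
      wInt p b (Ioi 0) (weakDeriv u 0) ≤ C₀ := by
    by_cases hb2 : -1 < b
    · obtain ⟨C₀, hC₀, h⟩ := exists_wInt_weakDeriv_le hb hα 0 (Nat.zero_le k) (by simpa using hb2)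
      refine ⟨C₀, hC₀, fun u hu _ => ?_⟩
      simpa using h u hu
    · exact ⟨0, ENNReal.zero_ne_top, fun u _ h => absurd h hb2⟩
  obtain ⟨C₀, hC₀, h₀⟩ := h₀
  refine ⟨1 + C₁ + C₀, ENNReal.add_ne_top.2 ⟨ENNReal.add_ne_top.2 ⟨ENNReal.one_ne_top, hC₁⟩, hC₀⟩,
    fun u hu => ?_⟩
  have hw := HasWeakDeriv.of_succ (hasWeakDeriv_weakDeriv u 0)
    (hasWeakDeriv_weakDeriv u ⟨1, by omega⟩)
  obtain ⟨U, hU, hUae⟩ := hw.exists_isPrimitive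
  refine ⟨U, ⟨_, hU, ?_, ?_, fun hb2 => ?_⟩, hUae.trans (weakDeriv_zero_ae u)⟩
  · rw [wInt_congr_ae subset_rfl hUae]
    exact (wInt_weakDeriv_le_one hu 0).trans (by rw [add_assoc]; exact le_self_add)
  · have := h₁ u hu
    rw [Nat.cast_one, one_mul] at this
    exact this.trans (le_add_self.trans le_self_add)
  · rw [wInt_congr_ae subset_rfl hUae]
    exact (h₀ u hu hb2).trans le_add_self

/-! ### The embedding operators -/

variable {q : ℝ} [Fact (1 ≤ q)] {θ : ℝ}

/-- A bound on the unit ball makes the identity a bounded operator into `L^q_θ`. -/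
theorem continuouslyEmbeds_of_bound
    (h : ∃ C : ℝ≥0∞, C ≠ ⊤ ∧ ∀ u : X k p α, ‖u‖ ≤ 1 → wInt q θ (Ioi 0) (toFun0 u) ≤ C) :
    ContinuouslyEmbeds k p α q θ := by
  obtain ⟨C, hC, h⟩ := h
  have hq : 0 < q := lt_of_lt_of_le one_pos Fact.out
  have hmeas : ∀ u : X k p α, AEStronglyMeasurable (toFun0 u) (volume.restrict (Ioi 0)) :=
    fun u => (toFun0 u).aestronglyMeasurable
  have hadd : ∀ u v : X k p α, toFun0 (u + v) =ᵐ[volume.restrict (Ioi 0)]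
      toFun0 u + toFun0 v := fun u v => AEEqFun.coeFn_add (toFun0 u) (toFun0 v)
  have hsmul : ∀ (c : ℝ) (u : X k p α), toFun0 (c • u) =ᵐ[volume.restrict (Ioi 0)]
      c • (toFun0 u : ℝ → ℝ) := fun c u => AEEqFun.coeFn_smul c (toFun0 u)
  have hscale : ∀ u : X k p α, ∃ v : X k p α, ‖v‖ ≤ 1 ∧ u = ‖u‖ • v := by
    intro u
    rcases eq_or_ne u 0 with rfl | hu
    · exact ⟨0, by simp, by simp⟩
    · have hu' := norm_ne_zero_iff.2 hu
      exact ⟨‖u‖⁻¹ • u, by rw [norm_smul, norm_inv, norm_norm, inv_mul_cancel₀ hu'],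
        by rw [smul_smul, mul_inv_cancel₀ hu', one_smul]⟩
  have hmem1 : ∀ u : X k p α, ‖u‖ ≤ 1 → MemLp (toFun0 u) (ENNReal.ofReal q) (weight θ) :=
    fun u hu => memLp_weight hq (hmeas u) (ne_top_of_le_ne_top hC (h u hu))
  have hmem : ∀ u : X k p α, MemLp (toFun0 u) (ENNReal.ofReal q) (weight θ) := by
    intro u
    obtain ⟨v, hv, huv⟩ := hscale u
    rw [huv]
    exact ((hmem1 v hv).const_smul ‖u‖).ae_eq ((ae_weight_iff θ).2 (hsmul ‖u‖ v).symm)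
  let T : X k p α →ₗ[ℝ] WLp q θ :=
    { toFun := fun u => (hmem u).toLp
      map_add' := fun u v => by
        rw [← MemLp.toLp_add, MemLp.toLp_eq_toLp_iff]
        exact (ae_weight_iff θ).2 (hadd u v)
      map_smul' := fun c u => by
        rw [RingHom.id_apply, ← MemLp.toLp_const_smul, MemLp.toLp_eq_toLp_iff]
        exact (ae_weight_iff θ).2 (hsmul c u) }
  have hT : ∀ u, T u =ᵐ[volume.restrict (Ioi 0)] toFun0 u := fun u =>
    (ae_weight_iff θ).1 (MemLp.coeFn_toLp (hmem u))
  have hT1 : ∀ u, ‖u‖ ≤ 1 → ‖T u‖ ≤ (C ^ q⁻¹).toReal := by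
    intro u hu
    have h1 : ‖T u‖ₑ ^ q ≤ C := by
      rw [enorm_WLp_rpow hq, wInt_congr_ae subset_rfl (hT u)]
      exact h u hu
    rw [← ENNReal.le_rpow_inv_iff hq] at h1
    rw [← toReal_enorm]
    exact ENNReal.toReal_mono (ENNReal.rpow_ne_top_of_nonneg (by positivity) hC) h1
  refine ⟨T.mkContinuous (C ^ q⁻¹).toReal fun u => ?_, hT⟩
  obtain ⟨v, hv, huv⟩ := hscale u
  calc ‖T u‖ = ‖u‖ * ‖T v‖ := by
        conv_lhs => rw [huv, map_smul, norm_smul, norm_norm]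
    _ ≤ ‖u‖ * (C ^ q⁻¹).toReal := by gcongr; exact hT1 v hv
    _ = _ := mul_comm _ _

/-- If the mass near `0` and near `∞` is uniformly small, the identity is a compact operator: what
remains lives on a compact interval, where finitely many integrals control it. -/
theorem compactlyEmbeds_of_small {a b : ℝ} {B : ℝ≥0∞} (hB : B ≠ ⊤)
    (hmem : ∀ u : X k p α, ‖u‖ ≤ 1 →
      ∃ U ∈ energyClass p a b B, U =ᵐ[volume.restrict (Ioi 0)] toFun0 u)
    (hemb : ContinuouslyEmbeds k p α q θ)
    (h0 : SmallAtZero q θ (energyClass p a b B)) (hinf : SmallAtInfty q θ (energyClass p a b B)) :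
    CompactlyEmbeds k p α q θ := by
  have hp1 : 1 ≤ p := Fact.out
  have hq1 : 1 ≤ q := Fact.out
  have hq : 0 < q := by linarith
  obtain ⟨T, hT⟩ := hemb
  refine ⟨T, hT, isCompactOperator_of_finite_rank_control T fun η hη => ?_⟩
  have hη' : ENNReal.ofReal η ^ q / 3 ≠ 0 := by
    refine ENNReal.div_ne_zero.2 ⟨?_, by simp⟩
    exact (ENNReal.rpow_pos (by simpa using hη) ENNReal.ofReal_ne_top).ne'
  obtain ⟨ε, hε, hε1, hUε⟩ := h0 _ hη'
  obtain ⟨R, hR, hUR⟩ := hinf _ hη'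
  obtain ⟨n, l, δ, hl, hδ, hmid⟩ := exists_wInt_Ioc_le_of_sum (a := a) (b := b) (θ := θ)
    (R := R + 1) hp1 hq1 hB hε (by linarith) hη'
  obtain ⟨M, hM, hUM⟩ := exists_enorm_le_on_Icc (a := a) (b := b) (R := ε + n * l) hp1 hB hε
  have hrep : ∀ (u : X k p α) (U : ℝ → ℝ), U =ᵐ[volume.restrict (Ioi 0)] toFun0 u → ∀ i : Fin n,
      intervalIntegrals k p α n hε hl u i =
        ∫ x in Ioc (ε + (i : ℕ) * l) (ε + (i : ℕ) * l + l), U x := by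
    intro u U hU i
    have hci : 0 < ε + (i : ℕ) * l := by positivity
    exact integral_congr_ae (ae_restrict_of_ae_restrict_of_subset
      (fun _ hx => hci.trans hx.1) hU.symm)
  refine ⟨n, intervalIntegrals k p α n hε hl, (M * ENNReal.ofReal l).toReal, δ / (n + 1),
    by positivity, fun u hu => ?_, fun u hu hLu => ?_⟩
  · obtain ⟨U, hU, hUae⟩ := hmem u hu
    refine (pi_norm_le_iff_of_nonneg ENNReal.toReal_nonneg).2 fun i => ?_
    rw [hrep u U hUae i, ← toReal_enorm]
    refine ENNReal.toReal_mono (ENNReal.mul_ne_top hM ENNReal.ofReal_ne_top) ?_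
    have hi : ((i : ℕ) : ℝ) + 1 ≤ n := by exact_mod_cast i.2
    calc _ ≤ ∫⁻ x in Ioc (ε + (i : ℕ) * l) (ε + (i : ℕ) * l + l), ‖U x‖ₑ :=
          enorm_integral_le_lintegral_enorm _
      _ ≤ ∫⁻ x in Ioc (ε + (i : ℕ) * l) (ε + (i : ℕ) * l + l), M := by
          refine setLIntegral_mono' measurableSet_Ioc fun x hx => hUM U hU x ⟨?_, ?_⟩
          · have : 0 ≤ ((i : ℕ) : ℝ) * l := by positivity
            linarith [hx.1]
          · have := mul_le_mul_of_nonneg_right hi hl.le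
            linarith [hx.2]
      _ = _ := by simp
  · obtain ⟨U, hU, hUae⟩ := hmem u hu
    have hsum : ∑ i ∈ Finset.range n, ‖∫ x in Ioc (ε + i * l) (ε + i * l + l), U x‖ₑ ≤
        ENNReal.ofReal δ := by
      rw [Finset.sum_range]
      calc _ ≤ ∑ _i : Fin n, ENNReal.ofReal (δ / (n + 1)) := by
            refine Finset.sum_le_sum fun i _ => ?_
            rw [← hrep u U hUae i, ← ofReal_norm]
            exact ENNReal.ofReal_le_ofReal ((norm_le_pi_norm _ i).trans hLu)
        _ = ENNReal.ofReal (n * (δ / (n + 1))) := by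
            rw [Finset.sum_const, Finset.card_univ, Fintype.card_fin, nsmul_eq_mul,
              ENNReal.ofReal_mul n.cast_nonneg, ENNReal.ofReal_natCast]
        _ ≤ _ := by
            refine ENNReal.ofReal_le_ofReal ?_
            rw [mul_div_assoc', div_le_iff₀ (by positivity)]
            nlinarith
    have hsplit : wInt q θ (Ioi 0) U ≤
        wInt q θ (Ioc 0 ε) U + (wInt q θ (Ioc ε (R + 1)) U + wInt q θ (Ioi (R + 1)) U) := by
      rw [wInt, ← Ioc_union_Ioi_eq_Ioi hε.le,
        ← Ioc_union_Ioi_eq_Ioi (by linarith : ε ≤ R + 1)]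
      exact (lintegral_union_le _ _ _).trans (add_le_add le_rfl (lintegral_union_le _ _ _))
    have hfin : ‖T u‖ₑ ^ q ≤ ENNReal.ofReal η ^ q := by
      rw [enorm_WLp_rpow hq, wInt_congr_ae subset_rfl ((hT u).trans hUae.symm)]
      calc _ ≤ _ := hsplit
        _ ≤ ENNReal.ofReal η ^ q / 3 + (ENNReal.ofReal η ^ q / 3 + ENNReal.ofReal η ^ q / 3) := by
            gcongr
            · exact hUε U hU
            · exact hmid U hU hsum
            · exact (wInt_mono_set (Ioi_subset_Ioi (by linarith))).trans (hUR U hU)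
        _ = _ := by rw [← add_assoc, ENNReal.add_thirds]
    rw [ENNReal.rpow_le_rpow_iff hq, ← ofReal_norm] at hfin
    exact (ENNReal.ofReal_le_ofReal_iff hη.le).1 hfin

end Space

end WeightedSobolev

open WeightedSobolev in
theorem mainTheorem1 (k : ℕ) (hk : 1 ≤ k) (p : ℝ) [Fact (1 ≤ p)] (α : Fin (k + 1) → ℝ) (θ : ℝ)
    (hα : ∀ j : Fin k, α j.castSucc ≥ α (Fin.last k) - ((k : ℝ) - (j : ℝ)) * p)
    (hθ₁ : α (Fin.last k) - k * p ≤ θ) (hθ₂ : θ ≤ α 0) :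
    (0 < α (Fin.last k) - k * p + 1 →
      ∀ (q : ℝ) [Fact (1 ≤ q)],
        (p ≤ q → q ≤ WeightedSobolev.criticalExponent k p α θ →
          WeightedSobolev.ContinuouslyEmbeds k p α q θ) ∧
        ((θ = α 0 ∧ p < q ∧ q < WeightedSobolev.criticalExponent k p α θ) ∨
            (θ < α 0 ∧ p ≤ q ∧ q < WeightedSobolev.criticalExponent k p α θ) →
          WeightedSobolev.CompactlyEmbeds k p α q θ)) ∧
    (α (Fin.last k) - k * p + 1 = 0 → (-1 < θ ∨ θ = α 0) →
      ∀ (q : ℝ) [Fact (1 ≤ q)],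
        (p ≤ q → WeightedSobolev.ContinuouslyEmbeds k p α q θ) ∧
        ((θ = α 0 ∧ p < q ∧ 1 < p ∧ -1 < α 0) ∨ (θ < α 0 ∧ p ≤ q) →
          WeightedSobolev.CompactlyEmbeds k p α q θ)) := by
  have hp : 1 ≤ p := Fact.out
  obtain ⟨b, hb⟩ : ∃ b, b = α (Fin.last k) - k * p := ⟨_, rfl⟩
  have hbk : α (Fin.last k) = b + k * p := by linarith
  have hαb : ∀ j : Fin (k + 1), b + j * p ≤ α j := by
    intro j
    refine Fin.lastCases ?_ (fun i => ?_) j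
    · rw [hbk, Fin.val_last]
    · have := hα i
      rw [Fin.val_castSucc]
      linarith
  have transfer : ∀ {q : ℝ} {B : ℝ≥0∞}, (∀ u : X k p α, ‖u‖ ≤ 1 →
      ∃ U ∈ energyClass p (α 0) b B, U =ᵐ[volume.restrict (Ioi 0)] toFun0 u) →
      (∃ C : ℝ≥0∞, C ≠ ⊤ ∧ ∀ U ∈ energyClass p (α 0) b B, wInt q θ (Ioi 0) U ≤ C) →
      ∃ C : ℝ≥0∞, C ≠ ⊤ ∧ ∀ u : X k p α, ‖u‖ ≤ 1 → wInt q θ (Ioi 0) (toFun0 u) ≤ C := by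
    rintro q B hmem ⟨C, hC, h⟩
    refine ⟨C, hC, fun u hu => ?_⟩
    obtain ⟨U, hU, hUae⟩ := hmem u hu
    rw [← wInt_congr_ae subset_rfl hUae]
    exact h U hU
  rw [criticalExponent, ← hb]
  rw [← hb] at hθ₁
  refine ⟨fun hb1 q _ => ?_, fun hb1 hθ q _ => ?_⟩
  · obtain ⟨B, hB, hmem⟩ := exists_mem_energyClass hk hbk hαb (by linarith)
    have hcont : p ≤ q → q ≤ (θ + 1) * p / (b + 1) → ContinuouslyEmbeds k p α q θ := by
      intro hpq hq
      rw [le_div_iff₀ hb1] at hq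
      exact continuouslyEmbeds_of_bound
        (transfer hmem (exists_wInt_le hp (by linarith) hB hθ₂ hpq hq))
    refine ⟨hcont, fun h => ?_⟩
    have hpq : p ≤ q := by rcases h with h | h <;> linarith [h.2.1]
    have hq : q < (θ + 1) * p / (b + 1) := by rcases h with h | h <;> exact h.2.2
    refine compactlyEmbeds_of_small hB hmem (hcont hpq hq.le)
      (smallAtZero_energyClass hp (by linarith) hB hpq ((lt_div_iff₀ hb1).1 hq))
      (smallAtInfty_energyClass hp (by linarith) hB hpq ?_)
    exact h.symm.imp (fun h => h.1) fun h => ⟨h.1.le, h.2.1⟩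
  · obtain rfl : b = -1 := by linarith
    obtain ⟨B, hB, hmem⟩ := exists_mem_energyClass hk hbk hαb le_rfl
    have ha : -1 ≤ α 0 := by linarith
    have hcont : p ≤ q → ContinuouslyEmbeds k p α q θ := by
      intro hpq
      refine continuouslyEmbeds_of_bound
        (transfer hmem (exists_wInt_le_limiting hp ha hB hpq hθ₂ ?_))
      rcases hθ₁.lt_or_eq with h | h
      · exact Or.inl h
      · rcases hθ with hθ | hθ
        · exact Or.inl hθ
        · exact Or.inr ⟨hθ, by linarith⟩
    refine ⟨hcont, fun h => ?_⟩
    have hpq : p ≤ q := by rcases h with h | h; exacts [h.2.1.le, h.2]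
    have hθ1 : -1 < θ := by
      rcases h with h | h
      · linarith [h.1, h.2.2.2]
      · exact hθ.resolve_right h.1.ne
    refine compactlyEmbeds_of_small hB hmem (hcont hpq)
      (smallAtZero_limiting hp ha hB (by linarith) hθ1)
      (smallAtInfty_limiting hp ha hB hpq ?_)
    exact h.symm.imp (fun h => h.1) fun h => ⟨h.1.le, h.2⟩
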